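/- Conventions. Let $n\ge 2$. A cabled linkage $\mathcal L$ in $\mathbb R^n$ consists of a finite simple graph with vertex set $\mathcal V$ and edge set $\mathcal E$, a length function $\ell:\mathcal E\to(0,\infty)$, a set $V\subset\mathcal V$ of fixed vertices with a map $\mu:V\to\mathbb R^n$, and a set $F\subset\mathcal E$ of flexible edges. Its configuration space $\mathcal C(\mathcal L)\subset(\mathbb R^n)^{\mathcal V}$ is the set of all $\varphi:\mathcal V\to\mathbb R^n$ such that $\varphi(v)=\mu(v)$ for $v\in V$, $|\varphi(v)-\varphi(w)|\le \ell(vw)$ for $vw\in F$, and $|\varphi(v)-\varphi(w)|=\ell(vw)$ for $vw\in\mathcal E\setminus F$. A quasialgebraic set is a subset of some $\mathbb R^d$ defined by finitely many polynomial equations $p_i(x)=0$ and finitely many polynomial inequalities $q_j(x)\ge 0$. A homeomorphism $f:X\to Y$ between subsets of Euclidean spaces is an isomorphism if $f$ and $f^{-1}$ are restrictions of entire rational maps (maps of the whole ambient space whose components are quotients of polynomials with nowhere vanishing denominators). A map on a subset of a Euclidean space is called analytic if it is the restriction of a real analytic map defined on an open set containing that subset, and a homeomorphism $f:X\to Y$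 is an analytic isomorphism if $f$ and $f^{-1}$ are analytic in this sense. Theorem. (1) Let $\mathcal L$ be a cabled linkage in $\mathbb R^n$, $n\ge 2$, and let $k$ be the number of connected components of $\mathcal L$ without fixed vertices. Then there is a compact quasialgebraic set $X$ such that $\mathcal C(\mathcal L)$ is isomorphic to $X\times(\mathbb R^n)^k$. (2) Conversely, let $n\ge 2$, let $X$ be a compact quasialgebraic set and let $k\ge 0$. Then there is a cabled linkage $\mathcal L$ in $\mathbb R^n$ such that $\mathcal C(\mathcal L)$ is analytically isomorphic to $X\times(\mathbb R^n)^k$. Moreover, if $X\subset(\mathbb R^n)^s$, then $\mathcal L$ may be chosen, with $s+m$ vertices for some $m$ listed in a suitable order, so that there is an analytic map $\alpha: X\times(\mathbb R^n)^k\to(\mathbb R^n)^m$ with $$\mathcal C(\mathcal L)=\{(x,\alpha(x,y))\mid x\in X,\ y\in(\mathbb R^n)^k\}\subset(\mathbb R^n)^s\times(\mathbb R^n)^m$$ and so that the map $(x,y)\mapsto(x,\alpha(x,y))$ is an analytic isomorphism from $X\times(\mathbb R^n)^k$ onto $\mathcal C(\mathcal L)$. -/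

import Mathlib

/-- A cabled linkage in `ℝⁿ` with vertex set `V` (finite wherever the notion is used): a simple
graph, a positive length for every edge, a set of fixed vertices with prescribed positions, and a
set of edges that are flexible. A classical linkage is the case where `flexible` is empty. -/
structure CabledLinkage (n : ℕ) (V : Type*) where
  graph : SimpleGraph V
  length : graph.edgeSet → ℝ
  length_pos : ∀ e, 0 < length e
  fixed : Set V
  position : fixed → EuclideanSpace ℝ (Fin n)
  flexible : Set graph.edgeSet

namespace CabledLinkage

/-- The configuration space: all placements of the vertices that respect the fixed vertices, the
upper bounds on the flexible edges and the exact lengths of the other edges. -/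
def configSpace {n : ℕ} {V : Type*} (L : CabledLinkage n V) :
    Set (V → EuclideanSpace ℝ (Fin n)) :=
  {φ | (∀ v : L.fixed, φ v = L.position v) ∧
    ∀ (v w : V) (h : L.graph.Adj v w),
      (⟨s(v, w), h⟩ ∈ L.flexible → ‖φ v - φ w‖ ≤ L.length ⟨s(v, w), h⟩) ∧
      (⟨s(v, w), h⟩ ∉ L.flexible → ‖φ v - φ w‖ = L.length ⟨s(v, w), h⟩)}

/-- The number of connected components that contain no fixed vertex. -/
noncomputable def numFreeComponents {n : ℕ} {V : Type*} (L : CabledLinkage n V) : ℕ :=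
  Nat.card {c : L.graph.ConnectedComponent // ∀ v ∈ c.supp, v ∉ L.fixed}

end CabledLinkage

/-- Real polynomial functions on a finite-dimensional real vector space: polynomial expressions in
linear functionals. On `ℝᵐ` these are the polynomials in the coordinates. -/
def IsPolynomialFunction {E : Type*} [AddCommGroup E] [Module ℝ E] (f : E → ℝ) : Prop :=
  ∃ p : MvPolynomial (Module.Dual ℝ E) ℝ, ∀ x : E, f x = MvPolynomial.eval (fun l => l x) p

/-- A set defined by finitely many polynomial equations `p i x = 0` and finitely many weak
polynomial inequalities `q j x ≥ 0`. -/
def IsQuasialgebraic {E : Type*} [AddCommGroup E] [Module ℝ E] (X : Set E) : Prop :=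
  ∃ (a b : ℕ) (p : Fin a → E → ℝ) (q : Fin b → E → ℝ),
    (∀ i, IsPolynomialFunction (p i)) ∧ (∀ j, IsPolynomialFunction (q j)) ∧
      X = {x | (∀ i, p i x = 0) ∧ ∀ j, 0 ≤ q j x}

/-- Entire rational maps: every component is a quotient of polynomial functions whose denominator
vanishes nowhere. -/
def IsEntireRational {E F : Type*} [AddCommGroup E] [Module ℝ E] [AddCommGroup F] [Module ℝ F]
    (f : E → F) : Prop :=
  ∀ l : Module.Dual ℝ F, ∃ p q : E → ℝ, IsPolynomialFunction p ∧ IsPolynomialFunction q ∧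
    (∀ x, q x ≠ 0) ∧ ∀ x, l (f x) = p x / q x

/-- `X` and `Y` are isomorphic: there is a homeomorphism `X → Y` such that it and its inverse are
restrictions of entire rational maps. -/
def AreIsomorphic {E F : Type*} [AddCommGroup E] [Module ℝ E] [TopologicalSpace E]
    [AddCommGroup F] [Module ℝ F] [TopologicalSpace F] (X : Set E) (Y : Set F) : Prop :=
  ∃ (f : X ≃ₜ Y) (g : E → F) (h : F → E), IsEntireRational g ∧ IsEntireRational h ∧
    (∀ x : X, (f x : F) = g x) ∧ (∀ y : Y, (f.symm y : E) = h y)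

/-- `f : X → F` is the restriction of a real analytic map defined on an open set containing `X`. -/
def IsAnalyticRestriction {E F : Type*} [NormedAddCommGroup E] [NormedSpace ℝ E]
    [NormedAddCommGroup F] [NormedSpace ℝ F] {X : Set E} (f : X → F) : Prop :=
  ∃ (U : Set E) (g : E → F), IsOpen U ∧ X ⊆ U ∧ AnalyticOnNhd ℝ g U ∧ ∀ x : X, f x = g x

/-- A homeomorphism `X → Y` is an analytic isomorphism if it and its inverse are restrictions of
analytic maps. -/
def IsAnalyticIsomorphism {E F : Type*} [NormedAddCommGroup E] [NormedSpace ℝ E]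
    [NormedAddCommGroup F] [NormedSpace ℝ F] {X : Set E} {Y : Set F} (f : X ≃ₜ Y) : Prop :=
  IsAnalyticRestriction (fun x : X => (f x : F)) ∧
    IsAnalyticRestriction (fun y : Y => (f.symm y : E))

/-- `X × (ℝⁿ)ᵏ` for a subset `X` of a space `E`. -/
abbrev timesEuclidean {E : Type*} (X : Set E) (n k : ℕ) :
    Set (E × (Fin k → EuclideanSpace ℝ (Fin n))) :=
  X ×ˢ Set.univ

/-! Part (1). Edges bound distances within a connected component, so a component with a fixed vertex
stays bounded and any other component is bounded up to translation. Pinning a base vertex of every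
free component at the origin leaves a compact quasialgebraic set, and the base positions supply the
factor (ℝⁿ)ᵏ. The splitting is linear (`CabledLinkage.areIsomorphic_configSpace`).

Part (2) is in the spirit of Kempe: linkages that compute. Only linkages whose auxiliary vertices
are single-valued analytic functions of the inputs are admitted (`Models`), so that configuration
spaces are graphs over the inputs. Bars alone leave several branches; a cable to a fixed point keeps
a joint near one of them. The resulting gadget, the elbow (`exists_drawable_elbow`), works only near
one point, but a homothety brings any compact set into its range (`Drawable.similarity`).

Elbows and braced parallelograms give sums and scalar multiples. Peaucellier's inversion of a circle
through the origin gives straight segments. Lines and sums give components along a basis and the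
transport of scalars between axes. A pair of bars gives reciprocals near 1, hence squares, products
and all polynomials. A polynomial equation then becomes a coincidence of vertices and an inequality
becomes a cable (`Realizable.setOf_polynomial`). A compact X lies in a ball, where all this applies,
and k unconstrained vertices supply (ℝⁿ)ᵏ. -/

/-! ### Sets cut out by distance constraints -/

/-- The sets of placements of `V` in `E` defined by finitely many fixed vertices, bars and
cables. -/
inductive IsLinkageSet {V E : Type*} [NormedAddCommGroup E] : Set (V → E) → Prop
  | univ : IsLinkageSet Set.univ
  | fix (v : V) (p : E) : IsLinkageSet {φ | φ v = p}
  | bar (v w : V) {l : ℝ} (hl : 0 < l) : IsLinkageSet {φ | ‖φ v - φ w‖ = l}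
  | cable (v w : V) {l : ℝ} (hl : 0 < l) : IsLinkageSet {φ | ‖φ v - φ w‖ ≤ l}
  | inter {S T : Set (V → E)} : IsLinkageSet S → IsLinkageSet T → IsLinkageSet (S ∩ T)

namespace IsLinkageSet

variable {V W E : Type*} [NormedAddCommGroup E]

theorem comap {S : Set (V → E)} (hS : IsLinkageSet S) (j : V → W) :
    IsLinkageSet {φ : W → E | φ ∘ j ∈ S} := by
  induction hS with
  | univ => exact .univ
  | fix v p => exact .fix (j v) p
  | bar v w hl => exact .bar (j v) (j w) hl
  | cable v w hl => exact .cable (j v) (j w) hl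
  | inter _ _ h₁ h₂ => exact .inter h₁ h₂

theorem similarity [NormedSpace ℝ E] {S : Set (V → E)} (hS : IsLinkageSet S) {c : ℝ} (hc : 0 < c)
    (p : E) : IsLinkageSet {φ : V → E | (fun v => c • φ v + p) ∈ S} := by
  have key (x y : E) : ‖(c • x + p) - (c • y + p)‖ = c * ‖x - y‖ := by
    rw [add_sub_add_right_eq_sub, ← smul_sub, norm_smul, Real.norm_of_nonneg hc.le]
  induction hS with
  | univ => exact .univ
  | fix v q =>
    convert IsLinkageSet.fix v (c⁻¹ • (q - p)) using 3
    rw [eq_inv_smul_iff₀ hc.ne', eq_sub_iff_add_eq]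
    rfl
  | @bar v w l hl =>
    convert IsLinkageSet.bar v w (div_pos hl hc) using 3
    rw [Set.mem_ofPred_eq, key, eq_div_iff hc.ne', mul_comm]
  | @cable v w l hl =>
    convert IsLinkageSet.cable v w (div_pos hl hc) using 3
    rw [Set.mem_ofPred_eq, key, le_div_iff₀ hc, mul_comm]
  | inter _ _ h₁ h₂ => exact .inter h₁ h₂

theorem setOf_and {p q : (V → E) → Prop} (hp : IsLinkageSet {φ | p φ})
    (hq : IsLinkageSet {φ | q φ}) : IsLinkageSet {φ | p φ ∧ q φ} :=
  .inter hp hq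

theorem setOf_forall {J : Type*} [Finite J] {p : J → (V → E) → Prop}
    (h : ∀ j, IsLinkageSet {φ | p j φ}) : IsLinkageSet {φ | ∀ j, p j φ} := by
  classical
  cases nonempty_fintype J
  have : ∀ s : Finset J, IsLinkageSet {φ | ∀ j ∈ s, p j φ} := by
    intro s
    induction s using Finset.induction_on with
    | empty => simpa using IsLinkageSet.univ
    | insert a s _ ih => simpa using setOf_and (h a) ih
  simpa using this Finset.univ

end IsLinkageSet

/-! ### From linkage sets to actual linkages -/

/-- A description of a cabled linkage by total functions. -/
structure LinkageData (V E : Type*) where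
  graph : SimpleGraph V
  length : Sym2 V → ℝ
  length_pos : ∀ e, 0 < length e
  flexible : Set (Sym2 V)
  fixed : Set V
  position : V → E

namespace LinkageData

variable {V E : Type*} [NormedAddCommGroup E]

/-- The placements that respect the fixed vertices, cables and bars. -/
def configSpace (A : LinkageData V E) : Set (V → E) :=
  {φ | (∀ v ∈ A.fixed, φ v = A.position v) ∧ ∀ v w, A.graph.Adj v w →
    (s(v, w) ∈ A.flexible → ‖φ v - φ w‖ ≤ A.length s(v, w)) ∧
    (s(v, w) ∉ A.flexible → ‖φ v - φ w‖ = A.length s(v, w))}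

open Classical in
/-- The linkage that imposes the constraints of both `A` and `B`. -/
noncomputable def merge (A B : LinkageData V E) : LinkageData V E where
  graph := A.graph ⊔ B.graph
  length e := if e ∈ A.graph.edgeSet then
    (if e ∈ B.graph.edgeSet then min (A.length e) (B.length e) else A.length e) else B.length e
  length_pos e := by
    have := A.length_pos e
    have := B.length_pos e
    split_ifs <;> simp [*]
  flexible := {e | (e ∈ A.graph.edgeSet → e ∈ A.flexible) ∧ (e ∈ B.graph.edgeSet → e ∈ B.flexible)}
  fixed := A.fixed ∪ B.fixed
  position v := if v ∈ A.fixed then A.position v else B.position v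

/-- A common placement makes the two sets of constraints compatible: fixed positions agree, two bars
on an edge have equal length, and a bar is no longer than a cable on the same edge. Hence the
minimum length is right in every case, and an edge stays flexible only if no bar lies on it. -/
theorem configSpace_merge (A B : LinkageData V E) {φ₀ : V → E} (hA : φ₀ ∈ A.configSpace)
    (hB : φ₀ ∈ B.configSpace) : (A.merge B).configSpace = A.configSpace ∩ B.configSpace := by
  classical
  ext φ
  simp only [configSpace, merge, Set.mem_ofPred_eq, Set.mem_inter_iff, Set.mem_union,
    SimpleGraph.sup_adj, SimpleGraph.mem_edgeSet] at *
  have hf : (∀ v, v ∈ A.fixed ∨ v ∈ B.fixed →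
      φ v = if v ∈ A.fixed then A.position v else B.position v) ↔
      (∀ v ∈ A.fixed, φ v = A.position v) ∧ (∀ v ∈ B.fixed, φ v = B.position v) := by
    rw [← forall_and]
    refine forall_congr' fun v => ?_
    have h₁ := hA.1 v
    have h₂ := hB.1 v
    by_cases v ∈ A.fixed <;> by_cases v ∈ B.fixed <;> grind
  rw [hf, and_and_and_comm]
  refine and_congr Iff.rfl ?_
  rw [← forall_and]
  refine forall_congr' fun v => ?_
  rw [← forall_and]
  refine forall_congr' fun w => ?_
  have h₁ := hA.2 v w
  have h₂ := hB.2 v w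
  generalize ‖φ v - φ w‖ = x at *
  generalize ‖φ₀ v - φ₀ w‖ = y at *
  generalize A.length s(v, w) = a at *
  generalize B.length s(v, w) = b at *
  by_cases A.graph.Adj v w <;> by_cases B.graph.Adj v w <;>
    by_cases s(v, w) ∈ A.flexible <;> by_cases s(v, w) ∈ B.flexible <;> grind

end LinkageData

/-- The empty set is kept apart because contradictory constraints on one edge or vertex cannot be
merged, and because a bar from a vertex to itself is not an edge of a simple graph. -/
theorem IsLinkageSet.exists_linkageData {V E : Type*} [NormedAddCommGroup E] {S : Set (V → E)}
    (hS : IsLinkageSet S) : S = ∅ ∨ ∃ A : LinkageData V E, A.configSpace = S := by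
  classical
  have huniv : ∃ A : LinkageData V E, A.configSpace = Set.univ :=
    ⟨⟨⊥, fun _ => 1, fun _ => one_pos, ∅, ∅, fun _ => 0⟩, by simp [LinkageData.configSpace]⟩
  induction hS with
  | univ => exact .inr huniv
  | fix v p =>
    exact .inr ⟨⟨⊥, fun _ => 1, fun _ => one_pos, ∅, {v}, fun _ => p⟩,
      by simp [LinkageData.configSpace]⟩
  | @bar v w l hl =>
    rcases eq_or_ne v w with rfl | hvw
    · left
      ext φ
      simp [hl.ne]
    · right
      refine ⟨⟨SimpleGraph.edge v w, fun _ => l, fun _ => hl, ∅, ∅, fun _ => 0⟩, ?_⟩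
      ext φ
      simp only [LinkageData.configSpace, SimpleGraph.edge_adj, Set.mem_ofPred_eq]
      have := norm_sub_rev (φ v) (φ w)
      grind
  | @cable v w l hl =>
    right
    rcases eq_or_ne v w with rfl | hvw
    · simpa [hl.le] using huniv
    · refine ⟨⟨SimpleGraph.edge v w, fun _ => l, fun _ => hl, Set.univ, ∅, fun _ => 0⟩, ?_⟩
      ext φ
      simp only [LinkageData.configSpace, SimpleGraph.edge_adj, Set.mem_ofPred_eq]
      have := norm_sub_rev (φ v) (φ w)
      grind
  | @inter S T _ _ h₁ h₂ =>
    rcases (S ∩ T).eq_empty_or_nonempty with h | ⟨φ, hφ⟩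
    · exact .inl h
    · right
      obtain ⟨A, rfl⟩ := h₁.resolve_left (Set.nonempty_iff_ne_empty.1 ⟨φ, hφ.1⟩)
      obtain ⟨B, rfl⟩ := h₂.resolve_left (Set.nonempty_iff_ne_empty.1 ⟨φ, hφ.2⟩)
      exact ⟨A.merge B, A.configSpace_merge B hφ.1 hφ.2⟩

theorem IsLinkageSet.exists_cabledLinkage {n : ℕ} {V : Type*}
    {S : Set (V → EuclideanSpace ℝ (Fin n))} (hS : IsLinkageSet S) (hne : S.Nonempty) :
    ∃ L : CabledLinkage n V, L.configSpace = S := by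
  obtain ⟨A, rfl⟩ := hS.exists_linkageData.resolve_left hne.ne_empty
  refine ⟨⟨A.graph, fun e => A.length e, fun e => A.length_pos e, A.fixed,
    fun v => A.position v, {e | (e : Sym2 V) ∈ A.flexible}⟩, ?_⟩
  ext φ
  simp [CabledLinkage.configSpace, LinkageData.configSpace]

/-! ### Realizable sets and drawable functions -/

section Models

variable {ι J K E : Type*} [Fintype ι] [Fintype J] [NormedAddCommGroup E] [NormedSpace ℝ E]

/-- `S` is a linkage set on the input vertices `ι` and auxiliary vertices `κ` whose placements are
those with inputs in `D`, the auxiliary vertices being analytic functions of the inputs. -/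
structure Models {κ : Type*} (D : Set (ι → E)) (S : Set (ι ⊕ κ → E)) (α : κ → (ι → E) → E) :
    Prop where
  isLinkageSet : IsLinkageSet S
  analytic : ∀ k, AnalyticOnNhd ℝ (α k) D
  mem_iff : ∀ x w, Sum.elim x w ∈ S ↔ x ∈ D ∧ ∀ k, w k = α k x

/-- `D` is the projection of the configuration space of a linkage whose remaining vertices are
analytic functions of the inputs. -/
def Realizable (D : Set (ι → E)) : Prop :=
  ∃ (κ : Type) (_ : Finite κ) (S : Set (ι ⊕ κ → E)) (α : κ → (ι → E) → E), Models D S α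

/-- `f` is analytic on `D`, and on `D` it is the position of a vertex of a linkage modelling `D`. -/
def Drawable (D : Set (ι → E)) (f : (ι → E) → E) : Prop :=
  AnalyticOnNhd ℝ f D ∧ ∃ (κ : Type) (_ : Finite κ) (S : Set (ι ⊕ κ → E))
    (α : κ → (ι → E) → E), Models D S α ∧ ∃ v, ∀ x ∈ D, f x = Sum.elim x (fun k => α k x) v

theorem Models.realizable {κ : Type} [Finite κ] {D : Set (ι → E)} {S : Set (ι ⊕ κ → E)}
    {α : κ → (ι → E) → E} (h : Models D S α) : Realizable D :=
  ⟨κ, ‹_›, S, α, h⟩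

theorem Drawable.realizable {D : Set (ι → E)} {f : (ι → E) → E} (h : Drawable D f) :
    Realizable D :=
  let ⟨_, κ, hκ, S, α, hS, _⟩ := h
  ⟨κ, hκ, S, α, hS⟩

theorem Drawable.analytic {D : Set (ι → E)} {f : (ι → E) → E} (h : Drawable D f) :
    AnalyticOnNhd ℝ f D :=
  h.1

theorem Drawable.congr {D : Set (ι → E)} {f g : (ι → E) → E} (h : Drawable D f)
    (hg : AnalyticOnNhd ℝ g D) (hfg : ∀ x ∈ D, g x = f x) : Drawable D g :=
  let ⟨_, κ, hκ, S, α, hS, v, hv⟩ := h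
  ⟨hg, κ, hκ, S, α, hS, v, fun x hx => (hfg x hx).trans (hv x hx)⟩

theorem analyticOnNhd_eval (D : Set (ι → E)) (i : ι) :
    AnalyticOnNhd ℝ (fun x : ι → E => x i) D :=
  (ContinuousLinearMap.proj (R := ℝ) (φ := fun _ : ι => E) i).analyticOnNhd D

theorem Realizable.eval {D : Set (ι → E)} (h : Realizable D) (i : ι) :
    Drawable D (fun x => x i) :=
  let ⟨κ, hκ, S, α, hS⟩ := h
  ⟨analyticOnNhd_eval D i, κ, hκ, S, α, hS, Sum.inl i, fun _ _ => rfl⟩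

theorem IsLinkageSet.realizable {D : Set (ι → E)} (h : IsLinkageSet D) : Realizable D := by
  refine ⟨Empty, inferInstance, _, fun k => k.elim,
    h.comap Sum.inl, fun k => k.elim, fun x w => ?_⟩
  simp [Set.mem_ofPred_eq]

theorem Models.inter {κ κ' : Type*} {D D' : Set (ι → E)} {S : Set (ι ⊕ κ → E)}
    {S' : Set (ι ⊕ κ' → E)} {α : κ → (ι → E) → E} {α' : κ' → (ι → E) → E}
    (h : Models D S α) (h' : Models D' S' α') :
    Models (D ∩ D') {φ | φ ∘ Sum.map id Sum.inl ∈ S ∧ φ ∘ Sum.map id Sum.inr ∈ S'}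
      (Sum.elim α α') where
  isLinkageSet := (h.isLinkageSet.comap _).inter (h'.isLinkageSet.comap _)
  analytic k := by
    cases k with
    | inl k => exact (h.analytic k).mono Set.inter_subset_left
    | inr k => exact (h'.analytic k).mono Set.inter_subset_right
  mem_iff x w := by
    have h₁ := h.mem_iff x (w ∘ Sum.inl)
    have h₂ := h'.mem_iff x (w ∘ Sum.inr)
    simp only [Set.mem_ofPred_eq, Sum.elim_comp_map, Function.comp_id, h₁, h₂, Sum.forall,
      Set.mem_inter_iff, Function.comp_apply, Sum.elim_inl, Sum.elim_inr]
    tauto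

theorem Realizable.inter {D D' : Set (ι → E)} (h : Realizable D) (h' : Realizable D') :
    Realizable (D ∩ D') :=
  let ⟨_, _, _, _, hS⟩ := h
  let ⟨_, _, _, _, hS'⟩ := h'
  (hS.inter hS').realizable

/-- Restriction to a smaller domain is enforced by running the linkage of `D'` beside that of `D`.
-/
theorem Drawable.mono {D D' : Set (ι → E)} {f : (ι → E) → E} (h : Drawable D f)
    (hD' : Realizable D') (hsub : D' ⊆ D) : Drawable D' f := by
  obtain ⟨hf, κ, hκ, S, α, hS, v, hv⟩ := h
  obtain ⟨κ', hκ', S', α', hS'⟩ := hD'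
  have := hS.inter hS'
  rw [Set.inter_eq_self_of_subset_right hsub] at this
  refine ⟨hf.mono hsub, κ ⊕ κ', inferInstance, _, _, this, Sum.map id Sum.inl v, fun x hx => ?_⟩
  rw [hv x (hsub hx)]
  cases v <;> rfl

/-- The linkages share only their inputs. An empty family would impose nothing and model all inputs
instead of `D`. -/
theorem Models.pi {L : Type*} [Nonempty L] [Finite L] {κ : L → Type*} {D : Set (ι → E)}
    {S : ∀ l, Set (ι ⊕ κ l → E)} {α : ∀ l, κ l → (ι → E) → E} (h : ∀ l, Models D (S l) (α l)) :
    Models D {φ | ∀ l, φ ∘ Sum.map id (Sigma.mk l) ∈ S l} (fun k : Σ l, κ l => α k.1 k.2) where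
  isLinkageSet := IsLinkageSet.setOf_forall fun l => (h l).isLinkageSet.comap _
  analytic k := (h k.1).analytic k.2
  mem_iff x w := by
    simp only [Set.mem_ofPred_eq, Sum.elim_comp_map, Function.comp_id, (h _).mem_iff,
      Sigma.forall, forall_and, Function.comp_apply, forall_const]

theorem Realizable.exists_models {L : Type} [Finite L] {D : Set (ι → E)} (hD : Realizable D)
    {f : L → (ι → E) → E} (hf : ∀ l, Drawable D (f l)) :
    ∃ (κ : Type) (_ : Finite κ) (S : Set (ι ⊕ κ → E)) (α : κ → (ι → E) → E), Models D S α ∧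
      ∃ v : L → ι ⊕ κ, ∀ l, ∀ x ∈ D, f l x = Sum.elim x (fun k => α k x) (v l) := by
  rcases isEmpty_or_nonempty L with hL | hL
  · obtain ⟨κ, hκ, S, α, hS⟩ := hD
    exact ⟨κ, hκ, S, α, hS, fun l => hL.elim l, fun l => hL.elim l⟩
  choose _ κ hκ S α hS v hv using hf
  refine ⟨Σ l, κ l, inferInstance, _, _, Models.pi hS, fun l => Sum.map id (Sigma.mk l) (v l),
    fun l x hx => (hv l x hx).trans ?_⟩
  change _ = Sum.elim x _ (Sum.map id (Sigma.mk l) (v l))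
  cases v l <;> rfl

/-- New vertices that are determined by constraints relative to drawable positions are
drawable, on the set of inputs for which the constraints can be satisfied. -/
theorem Realizable.extend {J K : Type} [Finite J] [Finite K] {D D' : Set (ι → E)}
    (hD : Realizable D) {f : J → (ι → E) → E} (hf : ∀ j, Drawable D (f j))
    {T : Set (J ⊕ K → E)} (hT : IsLinkageSet T) {β : K → (ι → E) → E}
    (hβ : ∀ k, AnalyticOnNhd ℝ (β k) D') (hsub : D' ⊆ D)
    (h : ∀ x ∈ D, ∀ w, Sum.elim (fun j => f j x) w ∈ T ↔ x ∈ D' ∧ ∀ k, w k = β k x) :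
    Realizable D' ∧ ∀ k, Drawable D' (β k) := by
  obtain ⟨κ, hκ, S, α, hS, v, hv⟩ := hD.exists_models hf
  -- The `J`-vertices of `T` are glued to the vertices `v j` that draw `f j`; only the `K`-vertices
  -- are new.
  have key : Models D' {φ | φ ∘ Sum.map id Sum.inl ∈ S ∧
      φ ∘ Sum.elim (Sum.map id Sum.inl ∘ v) (Sum.inr ∘ Sum.inr) ∈ T} (Sum.elim α β) := by
    refine ⟨(hS.isLinkageSet.comap _).inter (hT.comap _), ?_, fun x w => ?_⟩
    · rintro (k | k)
      · exact (hS.analytic k).mono hsub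
      · exact hβ k
    · have h₁ := hS.mem_iff x (w ∘ Sum.inl)
      simp only [Set.mem_ofPred_eq, Sum.elim_comp_map, Function.comp_id, h₁, Sum.forall,
        Function.comp_apply, Sum.elim_inl, Sum.elim_inr]
      constructor
      · rintro ⟨⟨hx, hw⟩, hT⟩
        have := (h x hx (w ∘ Sum.inr)).1 (by
          convert hT using 1
          funext j
          rcases j with j | j
          · simp only [Sum.elim_inl, Function.comp_apply, hv j x hx]
            cases v j <;> simp [hw]
          · rfl)
        exact ⟨this.1, hw, this.2⟩
      · rintro ⟨hx', hw, hw'⟩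
        have hx := hsub hx'
        refine ⟨⟨hx, hw⟩, ?_⟩
        convert (h x hx (w ∘ Sum.inr)).2 ⟨hx', hw'⟩ using 1
        funext j
        rcases j with j | j
        · simp only [Sum.elim_inl, Function.comp_apply, hv j x hx]
          cases v j <;> simp [hw]
        · rfl
  exact ⟨key.realizable, fun k => ⟨hβ k, _, inferInstance, _, _, key, Sum.inr (Sum.inr k),
    fun x hx => rfl⟩⟩

theorem Realizable.const {D : Set (ι → E)} (hD : Realizable D) (p : E) :
    Drawable D fun _ => p := by
  refine (hD.extend (J := Empty) (K := Unit) (f := fun j => j.elim) (fun j => j.elim)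
    (T := {φ | φ (Sum.inr ()) = p}) (.fix _ p) (β := fun _ _ => p)
    (fun _ => analyticOnNhd_const) subset_rfl fun x hx w => ?_).2 ()
  simp [hx, Set.mem_ofPred_eq, Unique.forall_iff]

theorem AnalyticOnNhd.comp_pi {D : Set (ι → E)} {D₂ : Set (J → E)} {g : (J → E) → E}
    (hg : AnalyticOnNhd ℝ g D₂) {f : J → (ι → E) → E} (hf : ∀ j, AnalyticOnNhd ℝ (f j) D)
    (h : ∀ x ∈ D, (fun j => f j x) ∈ D₂) : AnalyticOnNhd ℝ (fun x => g fun j => f j x) D :=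
  hg.comp (AnalyticOnNhd.pi hf) h

/-- The second linkage is mounted on the vertices that draw `f`. Inputs for which it cannot be
assembled drop out, so preimages of realizable sets come for free. -/
theorem Realizable.comp {J : Type} [Fintype J] {D : Set (ι → E)} (hD : Realizable D)
    {D₂ : Set (J → E)} (hD₂ : Realizable D₂) {f : J → (ι → E) → E}
    (hf : ∀ j, Drawable D (f j)) :
    Realizable {x | x ∈ D ∧ (fun j => f j x) ∈ D₂} ∧ ∀ g, Drawable D₂ g →
      Drawable {x | x ∈ D ∧ (fun j => f j x) ∈ D₂} fun x => g fun j => f j x := by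
  have hsub : {x | x ∈ D ∧ (fun j => f j x) ∈ D₂} ⊆ D := fun x hx => hx.1
  have hf' j := (hf j).analytic.mono hsub
  have key {κ : Type} (hκ : Finite κ) {S : Set (J ⊕ κ → E)} {α : κ → (J → E) → E}
      (hS : Models D₂ S α) := hD.extend hf hS.isLinkageSet
    (D' := {x | x ∈ D ∧ (fun j => f j x) ∈ D₂}) (β := fun k x => α k fun j => f j x)
    (fun k => (hS.analytic k).comp_pi hf' fun x hx => hx.2)
    hsub fun x hx w => by
      simp [hS.mem_iff, hx, Set.mem_ofPred_eq]
  obtain ⟨κ, hκ, S, α, hS⟩ := hD₂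
  refine ⟨(key hκ hS).1, ?_⟩
  rintro g ⟨hg, κ, hκ, S, α, hS, v, hv⟩
  have hg' := hg.comp_pi hf' fun x hx => hx.2
  rcases v with j | k
  · exact ((hf j).mono (key hκ hS).1 hsub).congr hg' fun x hx => hv _ hx.2
  · exact ((key hκ hS).2 k).congr hg' fun x hx => hv _ hx.2

/-- Composition with a function drawable on a set that contains all values. -/
theorem Drawable.comp {J : Type} [Fintype J] {D : Set (ι → E)} (hD : Realizable D)
    {D₂ : Set (J → E)} {g : (J → E) → E} (hg : Drawable D₂ g) {f : J → (ι → E) → E}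
    (hf : ∀ j, Drawable D (f j)) (h : ∀ x ∈ D, (fun j => f j x) ∈ D₂) :
    Drawable D fun x => g fun j => f j x := by
  convert (hD.comp hg.realizable hf).2 g hg using 1
  ext x
  exact ⟨fun hx => ⟨hx, h x hx⟩, fun hx => hx.1⟩

theorem Realizable.preimage {J : Type} [Fintype J] {D : Set (ι → E)} (hD : Realizable D)
    {D₂ : Set (J → E)} (hD₂ : Realizable D₂) {f : J → (ι → E) → E}
    (hf : ∀ j, Drawable D (f j)) : Realizable {x | x ∈ D ∧ (fun j => f j x) ∈ D₂} :=
  (hD.comp hD₂ hf).1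

theorem Realizable.comap {J : Type} [Fintype J] {D : Set (J → E)} (hD : Realizable D)
    (j : J → ι) : Realizable {x : ι → E | x ∘ j ∈ D} := by
  simpa [Function.comp_def] using (IsLinkageSet.univ (V := ι) (E := E)).realizable.preimage hD
    (f := fun i x => x (j i)) fun i => IsLinkageSet.univ.realizable.eval _

theorem Realizable.setOf_forall {D : Set (ι → E)} (hD : Realizable D) {L : Type*} [Finite L]
    {p : L → (ι → E) → Prop} (h : ∀ l, Realizable {x | x ∈ D ∧ p l x}) :
    Realizable {x | x ∈ D ∧ ∀ l, p l x} := by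
  classical
  cases nonempty_fintype L
  have (s : Finset L) : Realizable {x | x ∈ D ∧ ∀ l ∈ s, p l x} := by
    induction s using Finset.induction_on with
    | empty => simpa using hD
    | insert a s _ ih =>
      convert (h a).inter ih using 1
      ext x
      simp only [Set.mem_ofPred_eq, Set.mem_inter_iff, Finset.forall_mem_insert]
      tauto
  simpa using this Finset.univ

/-- If `Γ` is the graph of `γ` over `D`, then what is drawable on `Γ` is drawable on `D`. -/
theorem Drawable.of_graph {K : Type} [Fintype K] {D : Set (ι → E)} {Γ : Set (ι ⊕ K → E)}
    {γ : K → (ι → E) → E} (hγ : ∀ k, AnalyticOnNhd ℝ (γ k) D)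
    (hΓ : ∀ x w, Sum.elim x w ∈ Γ ↔ x ∈ D ∧ ∀ k, w k = γ k x) {g : (ι ⊕ K → E) → E}
    (hg : Drawable Γ g) : Drawable D fun x => g (Sum.elim x fun k => γ k x) := by
  have hpi (j : ι ⊕ K) : AnalyticOnNhd ℝ
      (fun x => (Sum.elim x (fun k => γ k x) : ι ⊕ K → E) j) D := by
    rcases j with j | j
    · exact analyticOnNhd_eval D j
    · exact hγ j
  have hmaps (x) (hx : x ∈ D) : (fun j => (Sum.elim x (fun k => γ k x) : ι ⊕ K → E) j) ∈ Γ :=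
    (hΓ x fun k => γ k x).2 ⟨hx, fun _ => rfl⟩
  obtain ⟨hg, κ, hκ, S, α, hS, v, hv⟩ := hg
  refine ⟨hg.comp_pi hpi hmaps, K ⊕ κ, inferInstance, {φ | φ ∘ Equiv.sumAssoc ι K κ ∈ S},
    Sum.elim γ fun k x => α k (Sum.elim x fun k => γ k x),
    ⟨hS.isLinkageSet.comap _, ?_, fun x w => ?_⟩, Equiv.sumAssoc ι K κ v, fun x hx => ?_⟩
  · rintro (k | k)
    · exact hγ k
    · exact (hS.analytic k).comp_pi hpi hmaps
  · have : Sum.elim x w ∘ Equiv.sumAssoc ι K κ =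
        Sum.elim (Sum.elim x (w ∘ Sum.inl)) (w ∘ Sum.inr) := by
      funext i
      rcases i with (i | i) | i <;> rfl
    simp only [Set.mem_ofPred_eq, this, hS.mem_iff, hΓ, Sum.forall, Function.comp_apply,
      Sum.elim_inl, Sum.elim_inr, and_assoc]
    refine and_congr_right fun _ => and_congr_right fun h => ?_
    have : w ∘ Sum.inl = fun k => γ k x := funext h
    rw [this]
  · refine (hv _ (hmaps x hx)).trans ?_
    rcases v with (v | v) | v <;> rfl

/-- Implicit definition: vertices first treated as inputs become auxiliary once the constraints
determine them analytically from the others. Inverse operations (segments, components, transfer,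
reciprocals) are built this way. -/
theorem Realizable.of_graph {K : Type} [Fintype K] {D : Set (ι → E)} {Γ : Set (ι ⊕ K → E)}
    (hΓr : Realizable Γ) {γ : K → (ι → E) → E} (hγ : ∀ k, AnalyticOnNhd ℝ (γ k) D)
    (hΓ : ∀ x w, Sum.elim x w ∈ Γ ↔ x ∈ D ∧ ∀ k, w k = γ k x) :
    Realizable D ∧ ∀ k, Drawable D (γ k) :=
  ⟨((hΓr.const 0).of_graph hγ hΓ).realizable, fun k => (hΓr.eval (Sum.inr k)).of_graph hγ hΓ⟩

end Models

/-! ### Rigid bars with marked points and braced parallelograms -/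

section Gadgets

open scoped RealInnerProductSpace

variable {ι E : Type*} [Fintype ι] [NormedAddCommGroup E] [InnerProductSpace ℝ E]
  {D : Set (ι → E)}

/-- Enlarging or shrinking a linkage rescales its domain; a gadget valid only near a point can thus
serve any compact set. -/
theorem Drawable.similarity {f : (ι → E) → E} (h : Drawable D f) {c : ℝ} (hc : 0 < c) (p : E) :
    Drawable {x | (fun i => c • x i + p) ∈ D}
      fun x : ι → E => c⁻¹ • (f (fun i => c • x i + p) - p) := by
  have han {g : (ι → E) → E} (hg : AnalyticOnNhd ℝ g D) : AnalyticOnNhd ℝ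
      (fun x : ι → E => c⁻¹ • (g (fun i => c • x i + p) - p)) {x | (fun i => c • x i + p) ∈ D} := by
    refine AnalyticOnNhd.smul analyticOnNhd_const (AnalyticOnNhd.sub ?_ analyticOnNhd_const)
    exact hg.comp_pi (fun i => (analyticOnNhd_const.smul (analyticOnNhd_eval _ i)).add
      analyticOnNhd_const) fun x hx => hx
  have hinv (y z : E) : y = c⁻¹ • (z - p) ↔ c • y + p = z := by
    rw [eq_inv_smul_iff₀ hc.ne', eq_sub_iff_add_eq]
  obtain ⟨hf, κ, hκ, S, α, hS, v, hv⟩ := h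
  refine ⟨han hf, κ, hκ, _, fun k (x : ι → E) => c⁻¹ • (α k (fun i => c • x i + p) - p),
    ⟨hS.isLinkageSet.similarity hc p, fun k => han (hS.analytic k), fun x w => ?_⟩, v,
    fun x hx => ?_⟩
  · have : (fun v => c • (Sum.elim x w : ι ⊕ κ → E) v + p) =
        Sum.elim (fun i => c • x i + p) (fun k => c • w k + p) := by
      funext i
      cases i <;> rfl
    simp only [Set.mem_ofPred_eq, this, hS.mem_iff, hinv]
  · change c⁻¹ • (f _ - p) = _
    rw [hv _ hx]
    cases v
    · simp [inv_smul_smul₀ hc.ne']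
    · rfl

/-- A vertex determined by bars and cables to drawable positions is drawable. -/
theorem Realizable.vertex (hD : Realizable D) {J J' : Type} [Finite J] [Finite J']
    {p : J → (ι → E) → E} (hp : ∀ j, Drawable D (p j)) {l : J → ℝ} (hl : ∀ j, 0 < l j)
    {q : J' → (ι → E) → E} (hq : ∀ j, Drawable D (q j)) {m : J' → ℝ} (hm : ∀ j, 0 < m j)
    {β : (ι → E) → E} (hβ : AnalyticOnNhd ℝ β D)
    (h : ∀ x ∈ D, ∀ w, ((∀ j, ‖w - p j x‖ = l j) ∧ ∀ j, ‖w - q j x‖ ≤ m j) ↔ w = β x) :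
    Drawable D β := by
  refine (hD.extend (J := J ⊕ J') (K := Unit) (f := Sum.elim p q) (Sum.forall.2 ⟨hp, hq⟩)
    (T := {φ | (∀ j, ‖φ (.inr ()) - φ (.inl (.inl j))‖ = l j) ∧
      ∀ j, ‖φ (.inr ()) - φ (.inl (.inr j))‖ ≤ m j})
    (.setOf_and (.setOf_forall fun j => .bar _ _ (hl j)) (.setOf_forall fun j => .cable _ _ (hm j)))
    (β := fun _ => β) (fun _ => hβ) subset_rfl fun x hx w => ?_).2 ()
  simpa [hx, Set.mem_ofPred_eq, Unique.forall_iff] using h x hx (w ())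

/-- Stewart's theorem. -/
theorem norm_sub_affine_sq (w f g : E) (t : ℝ) :
    ‖w - ((1 - t) • f + t • g)‖ ^ 2 =
      (1 - t) * ‖w - f‖ ^ 2 + t * ‖w - g‖ ^ 2 - t * (1 - t) * ‖f - g‖ ^ 2 := by
  simp only [← real_inner_self_eq_norm_sq, inner_sub_left, inner_sub_right, inner_add_left,
    inner_add_right, real_inner_smul_left, real_inner_smul_right, real_inner_comm w f,
    real_inner_comm w g, real_inner_comm f g]
  ring

/-- The prescribed distances make the right side of Stewart's identity vanish. Points outside the
segment are allowed, hence the absolute values. -/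
theorem eq_affine_iff {w f g : E} {t l : ℝ} (hfg : ‖f - g‖ = l) :
    (‖w - f‖ = |t| * l ∧ ‖w - g‖ = |1 - t| * l) ↔ w = (1 - t) • f + t • g := by
  constructor
  · rintro ⟨h₁, h₂⟩
    rw [← sub_eq_zero, ← norm_eq_zero, ← sq_eq_zero_iff, norm_sub_affine_sq, h₁, h₂, hfg,
      mul_pow, mul_pow, sq_abs, sq_abs]
    ring
  · rintro rfl
    have h₁ : (1 - t) • f + t • g - f = -(t • (f - g)) := by module
    have h₂ : (1 - t) • f + t • g - g = (1 - t) • (f - g) := by module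
    rw [h₁, h₂, norm_neg, norm_smul, norm_smul, hfg]
    exact ⟨rfl, rfl⟩

/-- Points on the line through two vertices at constant distance are drawable. -/
theorem Drawable.affine {f g : (ι → E) → E} (hf : Drawable D f) (hg : Drawable D g) {l : ℝ}
    (hl : ∀ x ∈ D, ‖f x - g x‖ = l) (t : ℝ) : Drawable D fun x => (1 - t) • f x + t • g x := by
  have han : AnalyticOnNhd ℝ (fun x => (1 - t) • f x + t • g x) D :=
    (analyticOnNhd_const.smul hf.analytic).add (analyticOnNhd_const.smul hg.analytic)
  rcases eq_or_ne t 0 with rfl | h0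
  · exact hf.congr han (by simp)
  rcases eq_or_ne t 1 with rfl | h1
  · exact hg.congr han (by simp)
  rcases le_or_gt l 0 with h | h
  · refine hf.congr han fun x hx => ?_
    have : f x = g x := by
      rw [← sub_eq_zero, ← norm_le_zero_iff, hl x hx]
      exact h
    rw [← this]
    module
  · refine hf.realizable.vertex (J := Fin 2) (J' := Empty) (p := ![f, g])
      (l := ![|t| * l, |1 - t| * l]) (Fin.forall_fin_two.2 ⟨hf, hg⟩)
      (Fin.forall_fin_two.2 ⟨mul_pos (abs_pos.2 h0) h, mul_pos (abs_pos.2 ?_) h⟩)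
      (q := fun j => j.elim) (fun j => j.elim) (m := fun j => j.elim) (fun j => j.elim) han
      fun x hx w => ?_
    · rwa [sub_ne_zero, ne_comm]
    · simpa [Fin.forall_fin_two] using eq_affine_iff (hl x hx)

/-- Rigidity of the braced parallelogram: `f, g, h` and the midpoint of `f, g` determine the fourth
vertex `c` and the midpoint `d` of `h, c`. -/
theorem braced_parallelogram {f g h c d : E} {a b : ℝ} (hfg : ‖f - g‖ = a)
    (hhg : ‖h - g‖ = b) :
    (‖c - f‖ = b ∧ ‖c - h‖ = a ∧ ‖d - h‖ = a / 2 ∧ ‖d - c‖ = a / 2 ∧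
      ‖d - ((1 / 2 : ℝ) • g + (1 / 2 : ℝ) • f)‖ = b) ↔
    c = f + h - g ∧ d = h + (1 / 2 : ℝ) • (f - g) := by
  constructor
  · rintro ⟨h₁, h₂, h₃, h₄, h₅⟩
    have hd : d = (1 - 1 / 2 : ℝ) • h + (1 / 2 : ℝ) • c := by
      refine (eq_affine_iff (by rw [norm_sub_rev, h₂])).1 ⟨?_, ?_⟩
      · rw [h₃, abs_of_pos] <;> linarith
      · rw [h₄, abs_of_pos] <;> linarith
    -- The brace is the average of the sides `h - g` and `c - f`, and all three have length `b`.
    -- Vectors of equal length whose average has that length coincide; this excludes the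
    -- antiparallelogram.
    have key := norm_sub_affine_sq (0 : E) (h - g) (c - f) (1 / 2)
    have h₆ : (0 : E) - ((1 - 1 / 2 : ℝ) • (h - g) + (1 / 2 : ℝ) • (c - f)) =
        -(d - ((1 / 2 : ℝ) • g + (1 / 2 : ℝ) • f)) := by
      rw [hd]
      module
    rw [h₆, norm_neg, h₅, zero_sub, norm_neg, zero_sub, norm_neg, hhg, h₁] at key
    have h₇ : ‖h - g - (c - f)‖ = 0 := by nlinarith [norm_nonneg (h - g - (c - f))]
    rw [norm_eq_zero, sub_eq_zero] at h₇
    have hc : c = f + h - g := by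
      rw [add_sub_assoc, h₇]
      abel
    refine ⟨hc, ?_⟩
    rw [hd, hc]
    module
  · rintro ⟨rfl, rfl⟩
    have e₁ : f + h - g - f = h - g := by abel
    have e₂ : f + h - g - h = f - g := by abel
    have e₃ : h + (1 / 2 : ℝ) • (f - g) - h = (1 / 2 : ℝ) • (f - g) := by abel
    have e₄ : h + (1 / 2 : ℝ) • (f - g) - (f + h - g) = -((1 / 2 : ℝ) • (f - g)) := by module
    have e₅ : h + (1 / 2 : ℝ) • (f - g) - ((1 / 2 : ℝ) • g + (1 / 2 : ℝ) • f) = h - g := by module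
    rw [e₁, e₂, e₃, e₄, e₅, norm_neg, norm_smul, hfg, hhg, Real.norm_of_nonneg (by norm_num)]
    refine ⟨rfl, rfl, ?_, ?_, rfl⟩ <;> ring

theorem Drawable.parallelogram {f g h : (ι → E) → E} (hf : Drawable D f) (hg : Drawable D g)
    (hh : Drawable D h) {a b : ℝ} (ha : ∀ x ∈ D, ‖f x - g x‖ = a)
    (hb : ∀ x ∈ D, ‖h x - g x‖ = b) : Drawable D fun x => f x + h x - g x := by
  have han := (hf.analytic.add hh.analytic).sub hg.analytic
  -- Bars need positive length, so degenerate parallelograms are treated separately.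
  rcases le_or_gt a 0 with h0 | ha0
  · refine hh.congr han fun x hx => ?_
    have : f x = g x := by
      rw [← sub_eq_zero, ← norm_le_zero_iff, ha x hx]
      exact h0
    simp [this]
  rcases le_or_gt b 0 with h0 | hb0
  · refine hf.congr han fun x hx => ?_
    have : h x = g x := by
      rw [← sub_eq_zero, ← norm_le_zero_iff, hb x hx]
      exact h0
    simp [this]
  have hm : Drawable D fun x => (1 / 2 : ℝ) • g x + (1 / 2 : ℝ) • f x := by
    have := hg.affine hf (fun x hx => by rw [norm_sub_rev, ha x hx]) (1 / 2)
    rwa [show (1 - 1 / 2 : ℝ) = 1 / 2 by norm_num] at this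
  refine (hf.realizable.extend (J := Fin 3) (K := Fin 2)
    (f := ![f, h, fun x => (1 / 2 : ℝ) • g x + (1 / 2 : ℝ) • f x])
    (Fin.forall_fin_succ.2 ⟨hf, Fin.forall_fin_two.2 ⟨hh, hm⟩⟩)
    (T := {φ | ‖φ (.inr 0) - φ (.inl 0)‖ = b ∧ ‖φ (.inr 0) - φ (.inl 1)‖ = a ∧
      ‖φ (.inr 1) - φ (.inl 1)‖ = a / 2 ∧ ‖φ (.inr 1) - φ (.inr 0)‖ = a / 2 ∧
      ‖φ (.inr 1) - φ (.inl 2)‖ = b})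
    (.setOf_and (.bar _ _ hb0) <| .setOf_and (.bar _ _ ha0) <|
      .setOf_and (.bar _ _ (half_pos ha0)) <| .setOf_and (.bar _ _ (half_pos ha0)) (.bar _ _ hb0))
    (β := ![fun x => f x + h x - g x, fun x => h x + (1 / 2 : ℝ) • (f x - g x)])
    (Fin.forall_fin_two.2 ⟨han, hh.analytic.add
      (analyticOnNhd_const.smul (hf.analytic.sub hg.analytic))⟩) subset_rfl fun x hx w => ?_).2 0
  have := braced_parallelogram (c := w 0) (d := w 1) (ha x hx) (hb x hx)
  simpa [Set.mem_ofPred_eq, hx, Fin.forall_fin_two] using this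

end Gadgets

/-! ### Elbows -/

section Elbow

open scoped RealInnerProductSpace

variable {E : Type*} [NormedAddCommGroup E] [InnerProductSpace ℝ E]

/-- The inner product with `x` of a point at distance `L` from `0` and `r` from `x`. -/
noncomputable def elbowInner (L r : ℝ) (x : E) : ℝ :=
  (L ^ 2 + ‖x‖ ^ 2 - r ^ 2) / 2

/-- The squared length of the projection of `x` to the plane spanned by `e` and `f`. -/
noncomputable def planeNormSq (e f x : E) : ℝ :=
  ⟪e, x⟫ ^ 2 + ⟪f, x⟫ ^ 2

/-- The square of the determinant of the projection of `x` and of the elbow. -/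
noncomputable def elbowDisc (e f : E) (L r : ℝ) (x : E) : ℝ :=
  L ^ 2 * planeNormSq e f x - elbowInner L r x ^ 2

/-- The point of the plane spanned by `e` and `f` at distance `L` from `0` and `r` from `x`,
on the side of `x` given by the sign `σ`. -/
noncomputable def elbow (e f : E) (L r σ : ℝ) (x : E) : E :=
  ((elbowInner L r x * ⟪e, x⟫ - σ * √(elbowDisc e f L r x) * ⟪f, x⟫) / planeNormSq e f x) • e +
    ((elbowInner L r x * ⟪f, x⟫ + σ * √(elbowDisc e f L r x) * ⟪e, x⟫) / planeNormSq e f x) • f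

variable {e f : E} {L r σ : ℝ}

theorem planeNormSq_pos {x : E} (h : 0 < elbowDisc e f L r x) : 0 < planeNormSq e f x := by
  unfold elbowDisc at h
  by_contra! h'
  nlinarith [sq_nonneg (elbowInner L r x), sq_nonneg L]

theorem continuous_elbowDisc : Continuous (elbowDisc e f L r) := by
  unfold elbowDisc elbowInner planeNormSq
  fun_prop

theorem analyticAt_elbow [CompleteSpace E] {x : E} (h : 0 < elbowDisc e f L r x) :
    AnalyticAt ℝ (elbow e f L r σ) x := by
  -- The smoothness exponent `⊤` means analytic; the square root is harmless because its argument is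
  -- positive.
  apply ContDiffAt.analyticAt
  have h₁ : ContDiffAt ℝ ⊤ (fun x => ⟪e, x⟫) x := contDiffAt_const.inner ℝ contDiffAt_id
  have h₂ : ContDiffAt ℝ ⊤ (fun x => ⟪f, x⟫) x := contDiffAt_const.inner ℝ contDiffAt_id
  have h₃ : ContDiffAt ℝ ⊤ (elbowInner L r) x := by
    unfold elbowInner
    exact ((contDiffAt_const.add (contDiffAt_id.norm_sq ℝ)).sub contDiffAt_const).div_const 2
  have h₄ : ContDiffAt ℝ ⊤ (planeNormSq e f) x := (h₁.pow 2).add (h₂.pow 2)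
  have h₅ : ContDiffAt ℝ ⊤ (fun x => √(elbowDisc e f L r x)) x :=
    ((contDiffAt_const.mul h₄).sub (h₃.pow 2)).sqrt h.ne'
  have h₆ := (planeNormSq_pos h).ne'
  exact ((((h₃.mul h₁).sub ((contDiffAt_const.mul h₅).mul h₂)).div h₄ h₆).smul
    contDiffAt_const).add ((((h₃.mul h₂).add ((contDiffAt_const.mul h₅).mul h₁)).div h₄ h₆).smul
    contDiffAt_const)

/-- `e` and `f` are orthogonal unit vectors. -/
structure OrthonormalPair (e f : E) : Prop where
  norm_left : ‖e‖ = 1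
  norm_right : ‖f‖ = 1
  inner_eq_zero : ⟪e, f⟫ = 0

theorem OrthonormalPair.symm (h : OrthonormalPair e f) : OrthonormalPair f e :=
  ⟨h.norm_right, h.norm_left, by rw [real_inner_comm, h.inner_eq_zero]⟩

theorem inner_left_plane (hef : OrthonormalPair e f) (a b : ℝ) : ⟪e, a • e + b • f⟫ = a := by
  simp [inner_add_right, real_inner_smul_right, hef.norm_left, hef.inner_eq_zero]

theorem inner_right_plane (hef : OrthonormalPair e f) (a b : ℝ) : ⟪f, a • e + b • f⟫ = b := by
  simp [inner_add_right, real_inner_smul_right, hef.norm_right, real_inner_comm e f,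
    hef.inner_eq_zero]

theorem norm_sq_plane (hef : OrthonormalPair e f) (a b : ℝ) : ‖a • e + b • f‖ ^ 2 = a ^ 2 + b ^ 2 := by
  rw [← real_inner_self_eq_norm_sq, inner_add_left, real_inner_smul_left, real_inner_smul_left,
    inner_left_plane hef, inner_right_plane hef]
  ring

theorem inner_plane (a b : ℝ) (x : E) : ⟪a • e + b • f, x⟫ = a * ⟪e, x⟫ + b * ⟪f, x⟫ := by
  rw [inner_add_left, real_inner_smul_left, real_inner_smul_left]

theorem norm_elbow (hef : OrthonormalPair e f) (hL : 0 < L) (hσ : σ ^ 2 = 1) {x : E} (h : 0 < elbowDisc e f L r x) :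
    ‖elbow e f L r σ x‖ = L := by
  rw [← sq_eq_sq₀ (norm_nonneg _) hL.le, elbow, norm_sq_plane hef]
  have h₁ := planeNormSq_pos h
  have h₂ := Real.sq_sqrt h.le
  rw [div_pow, div_pow, ← add_div, div_eq_iff (pow_pos h₁ 2).ne']
  generalize hs : √(elbowDisc e f L r x) = s at *
  unfold elbowDisc at h₂
  unfold planeNormSq at *
  linear_combination (⟪e, x⟫ ^ 2 + ⟪f, x⟫ ^ 2) * h₂ + s ^ 2 * (⟪e, x⟫ ^ 2 + ⟪f, x⟫ ^ 2) * hσ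

theorem norm_elbow_sub (hef : OrthonormalPair e f) (hL : 0 < L) (hr : 0 < r) (hσ : σ ^ 2 = 1) {x : E}
    (h : 0 < elbowDisc e f L r x) : ‖elbow e f L r σ x - x‖ = r := by
  have h₁ := planeNormSq_pos h
  have h₂ : ⟪elbow e f L r σ x, x⟫ = elbowInner L r x := by
    rw [elbow, inner_plane]
    unfold planeNormSq at *
    field_simp
    ring
  rw [← sq_eq_sq₀ (norm_nonneg _) hr.le, norm_sub_sq_real, norm_elbow hef hL hσ h, h₂,
    elbowInner]
  ring

/-- The two lengths fix the inner product with `x` and the square of the determinant with the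
projection of `x`; the side condition fixes its sign. Inner product and determinant determine a
point of the plane. -/
theorem eq_elbow (hef : OrthonormalPair e f) (hσ : σ ^ 2 = 1) {x : E} (h : 0 < elbowDisc e f L r x) {a b : ℝ}
    (h₁ : ‖a • e + b • f‖ = L) (h₂ : ‖a • e + b • f - x‖ = r)
    (h₃ : 0 < σ * (⟪e, x⟫ * b - ⟪f, x⟫ * a)) : a • e + b • f = elbow e f L r σ x := by
  have hL := norm_sq_plane hef a b
  have hr := norm_sub_sq_real (a • e + b • f) x
  rw [h₂, h₁, inner_plane] at hr
  rw [h₁] at hL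
  have hk : elbowInner L r x = a * ⟪e, x⟫ + b * ⟪f, x⟫ := by
    unfold elbowInner
    linarith
  have hs : √(elbowDisc e f L r x) = σ * (⟪e, x⟫ * b - ⟪f, x⟫ * a) := by
    rw [Real.sqrt_eq_iff_mul_self_eq h.le h₃.le, elbowDisc, hk, hL, planeNormSq]
    linear_combination -(⟪e, x⟫ * b - ⟪f, x⟫ * a) ^ 2 * hσ
  have hp := (planeNormSq_pos h).ne'
  unfold elbow
  rw [hs, hk]
  congr 2
  · rw [eq_div_iff hp, planeNormSq]
    linear_combination (⟪e, x⟫ * b - ⟪f, x⟫ * a) * ⟪f, x⟫ * hσ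
  · rw [eq_div_iff hp, planeNormSq]
    linear_combination -(⟪e, x⟫ * b - ⟪f, x⟫ * a) * ⟪e, x⟫ * hσ

/-- The strict sign persists nearby, which lets a short cable select the branch `σ`. -/
theorem cross_elbow (hef : OrthonormalPair e f) (hσ : σ ^ 2 = 1) {x : E} (h : 0 < elbowDisc e f L r x) :
    0 < σ * (⟪e, x⟫ * ⟪f, elbow e f L r σ x⟫ - ⟪f, x⟫ * ⟪e, elbow e f L r σ x⟫) := by
  have h₁ := planeNormSq_pos h
  rw [elbow, inner_left_plane hef, inner_right_plane hef]
  have : σ * (⟪e, x⟫ * ((elbowInner L r x * ⟪f, x⟫ + σ * √(elbowDisc e f L r x) * ⟪e, x⟫) /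
      planeNormSq e f x) - ⟪f, x⟫ * ((elbowInner L r x * ⟪e, x⟫ -
      σ * √(elbowDisc e f L r x) * ⟪f, x⟫) / planeNormSq e f x)) = √(elbowDisc e f L r x) := by
    generalize √(elbowDisc e f L r x) = s
    unfold planeNormSq at *
    field_simp
    linear_combination (⟪e, x⟫ ^ 2 + ⟪f, x⟫ ^ 2) * s * hσ
  rw [this]
  exact Real.sqrt_pos.2 h

variable [FiniteDimensional ℝ E]

/-- The points of a sphere around `0` that lie in a subspace are cut out by bars. -/
theorem exists_bars_iff_mem (P : Submodule ℝ E) (hL : 0 < L) :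
    ∃ (m : ℕ) (b : Fin m → E), ∀ w : E, ‖w‖ = L →
      ((∀ i, ‖w - b i‖ = √(L ^ 2 + 1)) ↔ w ∈ P) := by
  let b := stdOrthonormalBasis ℝ Pᗮ
  refine ⟨_, fun i => (b i : E), fun w hw => ?_⟩
  -- Pythagoras: `w` of length `L` is orthogonal to a unit vector exactly when their distance is the
  -- hypotenuse.
  have hb (i) : ‖w - b i‖ = √(L ^ 2 + 1) ↔ ⟪(b i : E), w⟫ = 0 := by
    rw [← sq_eq_sq₀ (norm_nonneg _) (Real.sqrt_nonneg _), Real.sq_sqrt (by positivity),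
      norm_sub_sq_real, hw, ← Submodule.coe_norm, b.norm_eq_one, real_inner_comm]
    constructor <;> intro h <;> linarith
  simp only [hb]
  conv_rhs => rw [← Submodule.orthogonal_orthogonal P, Submodule.mem_orthogonal]
  constructor
  · intro h u hu
    have := b.sum_repr ⟨u, hu⟩
    have h' := congrArg (fun z : Pᗮ => (z : E)) this
    simp only [Submodule.coe_sum, Submodule.coe_smul] at h'
    rw [← h', sum_inner]
    exact Finset.sum_eq_zero fun i _ => by rw [real_inner_smul_left, h, mul_zero]
  · exact fun h i => h _ (b i).2

theorem exists_drawable_elbow (hef : OrthonormalPair e f) (hL : 0 < L) (hr : 0 < r) (hσ : σ ^ 2 = 1) {x₀ : E}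
    (h₀ : 0 < elbowDisc e f L r x₀) : ∃ δ > 0, (∀ x, ‖x - x₀‖ ≤ δ → 0 < elbowDisc e f L r x) ∧
      Drawable {φ : Unit → E | ‖φ () - x₀‖ ≤ δ} fun φ => elbow e f L r σ (φ ()) := by
  obtain ⟨ε, hε, hcross⟩ : ∃ ε > 0, ∀ x w : E, ‖x - x₀‖ ≤ ε → ‖w - elbow e f L r σ x₀‖ ≤ ε →
      0 < σ * (⟪e, x⟫ * ⟪f, w⟫ - ⟪f, x⟫ * ⟪e, w⟫) := by
    have hc : Continuous fun p : E × E => σ * (⟪e, p.1⟫ * ⟪f, p.2⟫ - ⟪f, p.1⟫ * ⟪e, p.2⟫) := by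
      fun_prop
    have hev : ∀ᶠ p : E × E in nhds (x₀, elbow e f L r σ x₀),
        0 < σ * (⟪e, p.1⟫ * ⟪f, p.2⟫ - ⟪f, p.1⟫ * ⟪e, p.2⟫) :=
      hc.continuousAt.eventually_const_lt (cross_elbow hef hσ h₀)
    obtain ⟨ε, hε, h⟩ := Metric.eventually_nhds_iff.1 hev
    refine ⟨ε / 2, half_pos hε, fun x w hx hw => h (y := (x, w)) ?_⟩
    rw [Prod.dist_eq, max_lt_iff, dist_eq_norm, dist_eq_norm]
    exact ⟨hx.trans_lt (half_lt_self hε), hw.trans_lt (half_lt_self hε)⟩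
  have hev : ∀ᶠ x in nhds x₀, ‖elbow e f L r σ x - elbow e f L r σ x₀‖ ≤ ε ∧
      0 < elbowDisc e f L r x := by
    refine Filter.Eventually.and ?_ (continuous_elbowDisc.continuousAt.eventually_const_lt h₀)
    simpa only [mem_closedBall_iff_norm] using (analyticAt_elbow (σ := σ) h₀).continuousAt.eventually_mem
      (Metric.closedBall_mem_nhds _ hε)
  obtain ⟨δ₀, hδ₀, hnear⟩ := Metric.eventually_nhds_iff.1 hev
  simp only [dist_eq_norm] at hnear
  have hδpos : 0 < min (δ₀ / 2) ε := lt_min (half_pos hδ₀) hε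
  have hδ (x : E) (hx : ‖x - x₀‖ ≤ min (δ₀ / 2) ε) : ‖x - x₀‖ < δ₀ :=
    (hx.trans (min_le_left _ _)).trans_lt (half_lt_self hδ₀)
  refine ⟨_, hδpos, fun x hx => (hnear (hδ x hx)).2, ?_⟩
  have hD₀ := (IsLinkageSet.univ (V := Unit) (E := E)).realizable
  have hD : Realizable {φ : Unit → E | ‖φ () - x₀‖ ≤ min (δ₀ / 2) ε} := by
    simpa using hD₀.preimage (D₂ := {ψ : Fin 2 → E | ‖ψ 0 - ψ 1‖ ≤ min (δ₀ / 2) ε})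
      (IsLinkageSet.cable _ _ hδpos).realizable (f := ![fun φ => φ (), fun _ => x₀])
      (Fin.forall_fin_two.2 ⟨hD₀.eval (), hD₀.const _⟩)
  obtain ⟨m, b, hb⟩ := exists_bars_iff_mem (Submodule.span ℝ {e, f}) hL
  -- Bars of lengths `L` and `r` form the arm, bars to the `b i` keep the joint in the plane, and a
  -- cable of length `ε` keeps it on the side `σ`.
  refine hD.vertex (J := Fin 2 ⊕ Fin m) (J' := Unit)
    (p := Sum.elim ![fun _ => 0, fun φ => φ ()] fun i _ => b i)
    (l := Sum.elim ![L, r] fun _ => √(L ^ 2 + 1))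
    (q := fun _ _ => elbow e f L r σ x₀) (m := fun _ => ε)
    (Sum.forall.2 ⟨Fin.forall_fin_two.2 ⟨hD.const _, hD.eval _⟩, fun i => hD.const _⟩)
    (Sum.forall.2 ⟨Fin.forall_fin_two.2 ⟨hL, hr⟩, fun _ => Real.sqrt_pos.2 (by positivity)⟩)
    (fun _ => hD.const _) (fun _ => hε) ?_ fun φ hφ w => ?_
  · intro φ hφ
    exact (analyticAt_elbow (hnear (hδ _ hφ)).2).comp
      (f := fun φ : Unit → E => φ ()) (analyticOnNhd_eval _ () φ hφ)
  · have hφ' : ‖φ () - x₀‖ ≤ min (δ₀ / 2) ε := hφ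
    obtain ⟨hn₁, hn₂⟩ := hnear (hδ _ hφ')
    simp only [Sum.forall, Fin.forall_fin_two, Sum.elim_inl, Sum.elim_inr, Matrix.cons_val_zero,
      Matrix.cons_val_one, sub_zero, forall_const]
    constructor
    · rintro ⟨⟨⟨h₁, h₂⟩, h₃⟩, h₄⟩
      obtain ⟨a, c, rfl⟩ := Submodule.mem_span_pair.1 ((hb w h₁).1 h₃)
      have := hcross _ _ (hφ'.trans (min_le_right _ _)) h₄
      rw [inner_left_plane hef, inner_right_plane hef] at this
      exact eq_elbow hef hσ hn₂ h₁ h₂ this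
    · rintro rfl
      have h₁ := norm_elbow hef hL hσ hn₂
      exact ⟨⟨⟨h₁, norm_elbow_sub hef hL hr hσ hn₂⟩,
        (hb _ h₁).2 (Submodule.mem_span_pair.2 ⟨_, _, rfl⟩)⟩, hn₁⟩

end Elbow

/-! ### Vector operations -/

section VectorOperations

open scoped RealInnerProductSpace

variable {ι E : Type*} [Fintype ι] [NormedAddCommGroup E] [InnerProductSpace ℝ E]
  {D : Set (ι → E)}

theorem Drawable.exists_norm_le {f : (ι → E) → E} (hf : Drawable D f) (hD : IsCompact D) :
    ∃ R > 0, ∀ x ∈ D, ‖f x‖ ≤ R := by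
  obtain ⟨C, hC⟩ := hD.exists_bound_of_continuousOn hf.analytic.continuousOn
  exact ⟨max C 1, lt_max_of_lt_right one_pos, fun x hx => (hC x hx).trans (le_max_left _ _)⟩

theorem Drawable.congr_fun {f g : (ι → E) → E} (h : Drawable D f) (hfg : ∀ x, f x = g x) :
    Drawable D g :=
  funext hfg ▸ h

theorem Drawable.parallelogram' {f g h k : (ι → E) → E} (hf : Drawable D f) (hg : Drawable D g)
    (hh : Drawable D h) {a b : ℝ} {u v : (ι → E) → E} (ha : ∀ x ∈ D, ‖u x‖ = a)
    (hb : ∀ x ∈ D, ‖v x‖ = b) (hu : ∀ x, f x - g x = u x) (hv : ∀ x, h x - g x = v x)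
    (hk : ∀ x, f x + h x - g x = k x) : Drawable D k :=
  (hf.parallelogram hg hh (fun x hx => by rw [hu, ha x hx])
    (fun x hx => by rw [hv, hb x hx])).congr_fun hk

theorem Realizable.setOf_norm_sub_le {g h : (ι → E) → E} (hg : Drawable D g) (hh : Drawable D h)
    {l : ℝ} (hl : 0 < l) : Realizable {x | x ∈ D ∧ ‖g x - h x‖ ≤ l} := by
  simpa using hg.realizable.preimage (J := Fin 2) (D₂ := {φ | ‖φ 0 - φ 1‖ ≤ l})
    (IsLinkageSet.cable _ _ hl).realizable (f := ![g, h]) (Fin.forall_fin_two.2 ⟨hg, hh⟩)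

theorem Realizable.setOf_norm_sub_eq {g h : (ι → E) → E} (hg : Drawable D g) (hh : Drawable D h)
    {l : ℝ} (hl : 0 < l) : Realizable {x | x ∈ D ∧ ‖g x - h x‖ = l} := by
  simpa using hg.realizable.preimage (J := Fin 2) (D₂ := {φ | ‖φ 0 - φ 1‖ = l})
    (IsLinkageSet.bar _ _ hl).realizable (f := ![g, h]) (Fin.forall_fin_two.2 ⟨hg, hh⟩)

variable [FiniteDimensional ℝ E] {e f : E}

/-- A drawable position is joined to a fixed point by two bars with a drawable joint. -/
theorem Drawable.exists_arm (hef : OrthonormalPair e f) (hD : IsCompact D) {g : (ι → E) → E}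
    (hg : Drawable D g) : ∃ (P : E) (r : ℝ) (B : (ι → E) → E), Drawable D B ∧
      (∀ x ∈ D, ‖B x - P‖ = r) ∧ ∀ x ∈ D, ‖g x - B x‖ = r := by
  -- An equilateral triangle with unit sides: the discriminant is 3/4.
  have h₀ : 0 < elbowDisc e f 1 1 e := by
    simp only [elbowDisc, elbowInner, planeNormSq, real_inner_self_eq_norm_sq, hef.norm_left,
      real_inner_comm e f, hef.inner_eq_zero]
    norm_num
  obtain ⟨δ, hδ, hpos, hdraw⟩ :=
    exists_drawable_elbow hef one_pos one_pos (one_pow 2 : (1 : ℝ) ^ 2 = 1) h₀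
  obtain ⟨R, hR, hgR⟩ := hg.exists_norm_le hD
  have hc : 0 < δ / R := div_pos hδ hR
  -- Scaling by `δ / R` and shifting by `e` brings all values of `g` into the range of the elbow.
  have hnear (x) (hx : x ∈ D) : ‖(δ / R) • g x + e - e‖ ≤ δ := by
    rw [add_sub_cancel_right, norm_smul, Real.norm_of_nonneg hc.le, div_mul_eq_mul_div,
      div_le_iff₀ hR]
    exact mul_le_mul_of_nonneg_left (hgR x hx) hδ.le
  refine ⟨-((δ / R)⁻¹ • e), (δ / R)⁻¹, _,
    (hdraw.similarity hc e).comp hg.realizable (f := fun _ => g) (fun _ => hg) hnear,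
    fun x hx => ?_, fun x hx => ?_⟩
  · rw [sub_neg_eq_add, ← smul_add, sub_add_cancel, norm_smul,
      norm_elbow hef one_pos (one_pow 2) (hpos _ (hnear x hx)), mul_one,
      Real.norm_of_nonneg (inv_pos.2 hc).le]
  · have : g x - (δ / R)⁻¹ • (elbow e f 1 1 1 ((δ / R) • g x + e) - e) =
        -((δ / R)⁻¹ • (elbow e f 1 1 1 ((δ / R) • g x + e) - ((δ / R) • g x + e))) := by
      rw [← sub_sub, sub_right_comm _ _ e, smul_sub _ _ ((δ / R) • g x), inv_smul_smul₀ hc.ne']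
      abel
    rw [this, norm_neg, norm_smul,
      norm_elbow_sub hef one_pos one_pos (one_pow 2) (hpos _ (hnear x hx)), mul_one,
      Real.norm_of_nonneg (inv_pos.2 hc).le]

namespace Drawable

variable {g h : (ι → E) → E}

/-- Parallelograms need sides of constant length, which the arms `P`, `B`, `g` and `Q`, `C`, `h`
provide. The grid of sums of a point of one arm and a point of the other is filled cell by cell,
starting from the constant `P + Q`. -/
theorem add (hef : OrthonormalPair e f) (hD : IsCompact D) (hg : Drawable D g)
    (hh : Drawable D h) : Drawable D fun x => g x + h x := by
  obtain ⟨P, r, B, hB, h₁, h₂⟩ := hg.exists_arm hef hD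
  obtain ⟨Q, s, C, hC, h₃, h₄⟩ := hh.exists_arm hef hD
  have hP := hB.realizable.const P
  have hQ := hB.realizable.const Q
  have hPQ := hB.realizable.const (P + Q)
  have hp : ∀ x ∈ D, ‖P‖ = ‖P‖ := fun _ _ => rfl
  have hq : ∀ x ∈ D, ‖Q‖ = ‖Q‖ := fun _ _ => rfl
  have hBQ : Drawable D fun x => B x + Q := hB.parallelogram' hP hPQ h₁ hq
    (fun x => by abel) (fun x => by abel) (fun x => by abel)
  have hgQ : Drawable D fun x => g x + Q := hg.parallelogram' hB hBQ h₂ hq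
    (fun x => by abel) (fun x => by abel) (fun x => by abel)
  have hPC : Drawable D fun x => P + C x := hC.parallelogram' hQ hPQ h₃ hp
    (fun x => by abel) (fun x => by abel) (fun x => by abel)
  have hBC : Drawable D fun x => B x + C x := hPC.parallelogram' hPQ hBQ h₃ h₁
    (fun x => by abel) (fun x => by abel) (fun x => by abel)
  have hgC : Drawable D fun x => g x + C x := hBC.parallelogram' hBQ hgQ h₃ h₂
    (fun x => by abel) (fun x => by abel) (fun x => by abel)
  have hPh : Drawable D fun x => P + h x := hh.parallelogram' hC hPC h₄ hp
    (fun x => by abel) (fun x => by abel) (fun x => by abel)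
  have hBh : Drawable D fun x => B x + h x := hPh.parallelogram' hPC hBC h₄ h₁
    (fun x => by abel) (fun x => by abel) (fun x => by abel)
  exact hBh.parallelogram' hBC hgC h₄ h₂
    (fun x => by abel) (fun x => by abel) (fun x => by abel)

/-- A pantograph: points dividing both bars of the arm in ratio `t` span a parallelogram at `B`
whose fourth vertex is the image of `g` under the homothety of ratio `t` about `P`. -/
theorem const_smul (hef : OrthonormalPair e f) (hD : IsCompact D) (hg : Drawable D g) (t : ℝ) :
    Drawable D fun x => t • g x := by
  obtain ⟨P, r, B, hB, h₁, h₂⟩ := hg.exists_arm hef hD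
  have hP := hB.realizable.const P
  have k₁ := hB.affine hP h₁ (1 - t)
  have k₂ := hB.affine hg (fun x hx => (norm_sub_rev _ _).trans (h₂ x hx)) t
  have k₃ := k₂.parallelogram' hB k₁ (a := |t| * r) (b := |1 - t| * r)
    (u := fun x => t • (g x - B x)) (v := fun x => -((1 - t) • (B x - P)))
    (k := fun x => P + t • (g x - P))
    (fun x hx => by rw [norm_smul, h₂ x hx, Real.norm_eq_abs])
    (fun x hx => by rw [norm_neg, norm_smul, h₁ x hx, Real.norm_eq_abs])
    (fun x => by module) (fun x => by module) (fun x => by module)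
  exact (k₃.add hef hD (hP.realizable.const (t • P - P))).congr_fun fun x => by module

theorem neg (hef : OrthonormalPair e f) (hD : IsCompact D) (hg : Drawable D g) :
    Drawable D fun x => -g x :=
  (hg.const_smul hef hD (-1)).congr_fun fun x => by module

theorem sub (hef : OrthonormalPair e f) (hD : IsCompact D) (hg : Drawable D g)
    (hh : Drawable D h) : Drawable D fun x => g x - h x :=
  (hg.add hef hD (hh.neg hef hD)).congr_fun fun x => by abel

end Drawable

theorem Realizable.finset_sum (hef : OrthonormalPair e f) (hD : IsCompact D) (hr : Realizable D)
    {J : Type*} (s : Finset J) {g : J → (ι → E) → E} (hg : ∀ j, Drawable D (g j)) :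
    Drawable D fun x => ∑ j ∈ s, g j x := by
  classical
  induction s using Finset.induction_on with
  | empty => simpa using hr.const 0
  | insert a s ha ih => simpa [Finset.sum_insert ha] using (hg a).add hef hD ih

/-- The inputs for which two drawable positions agree form a realizable set. -/
theorem Realizable.setOf_eq (hef : OrthonormalPair e f) (hD : IsCompact D) {g h : (ι → E) → E}
    (hg : Drawable D g) (hh : Drawable D h) : Realizable {x | x ∈ D ∧ g x = h x} := by
  simpa [sub_eq_zero] using hg.realizable.preimage (J := Unit) (D₂ := {φ | φ () = 0})
    (IsLinkageSet.fix _ _).realizable (f := fun _ x => g x - h x) fun _ => hg.sub hef hD hh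

end VectorOperations

/-! ### Straight lines -/

section Lines

open scoped RealInnerProductSpace

variable {ι E : Type*} [Fintype ι] [NormedAddCommGroup E] [InnerProductSpace ℝ E]

theorem realizable_box {c : ι → E} {R : ι → ℝ} (hR : ∀ i, 0 < R i) :
    Realizable {φ : ι → E | ∀ i, ‖φ i - c i‖ ≤ R i} := by
  have h₀ := (IsLinkageSet.univ (V := ι) (E := E)).realizable
  let e := Fintype.equivFin ι
  simpa [Set.mem_ofPred_eq, e.symm.forall_congr_left] using h₀.preimage
    (J := Fin (Fintype.card ι) ⊕ Fin (Fintype.card ι))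
    (D₂ := {ψ | ∀ i, ‖ψ (.inl i) - ψ (.inr i)‖ ≤ R (e.symm i)})
    (IsLinkageSet.setOf_forall fun i => .cable _ _ (hR _)).realizable
    (f := Sum.elim (fun i x => x (e.symm i)) fun i _ => c (e.symm i))
    (Sum.forall.2 ⟨fun i => h₀.eval _, fun i => h₀.const _⟩)

variable {e f : E}

/-- Peaucellier's inversor: the two elbows and `y` span a rhombus whose fourth vertex is the inverse
of `y`, with power 4 - 2 = 2. -/
theorem elbow_add_elbow_sub (hef : OrthonormalPair e f) {y : E}
    (hy : y ∈ Submodule.span ℝ {e, f}) (h : 0 < elbowDisc e f 2 (√2) y) :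
    elbow e f 2 (√2) 1 y + elbow e f 2 (√2) (-1) y - y = (2 / ‖y‖ ^ 2) • y := by
  have hpos := planeNormSq_pos h
  obtain ⟨a, b, rfl⟩ := Submodule.mem_span_pair.1 hy
  unfold elbow
  generalize √(elbowDisc e f 2 (√2) (a • e + b • f)) = s
  unfold planeNormSq elbowInner at *
  rw [inner_left_plane hef, inner_right_plane hef] at *
  rw [norm_sq_plane hef, Real.sq_sqrt (by norm_num)]
  match_scalars <;> field_simp <;> ring

variable [FiniteDimensional ℝ E]

theorem isCompact_box {κ : Type*} (c : κ → E) (R : κ → ℝ) :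
    IsCompact {φ : κ → E | ∀ i, ‖φ i - c i‖ ≤ R i} := by
  convert isCompact_univ_pi fun i => isCompact_closedBall (c i) (R i) using 1
  ext φ
  simp [dist_eq_norm]

theorem realizable_sphere_inter (P : Submodule ℝ E) {L : ℝ} (hL : 0 < L) :
    Realizable {φ : Unit → E | ‖φ ()‖ = L ∧ φ () ∈ P} := by
  have h₀ := (IsLinkageSet.univ (V := Unit) (E := E)).realizable
  obtain ⟨m, b, hb⟩ := exists_bars_iff_mem P hL
  have hs : 0 < √(L ^ 2 + 1) := Real.sqrt_pos.2 (by positivity)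
  have hT : IsLinkageSet {ψ : Option (Fin m) ⊕ Unit → E | ‖ψ (.inr ()) - ψ (.inl none)‖ = L ∧
      ∀ i, ‖ψ (.inr ()) - ψ (.inl (some i))‖ = √(L ^ 2 + 1)} :=
    .setOf_and (.bar _ _ hL) (.setOf_forall fun i => .bar _ _ hs)
  convert h₀.preimage hT.realizable
    (f := Sum.elim (fun i _ => i.elim 0 b) fun _ φ => φ ())
    (Sum.forall.2 ⟨fun i => h₀.const _, fun i => h₀.eval _⟩) using 2
  ext φ
  simpa using fun h => (hb _ h).symm

/-- Inversion of an arc of a circle through the origin: a segment of a line off the origin. -/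
theorem exists_realizable_segment (hef : OrthonormalPair e f) :
    ∃ δ > 0, Realizable {φ : Unit → E | ∃ t : ℝ, |t| ≤ δ ∧ φ () = e + t • f} := by
  have h₀ : 0 < elbowDisc e f 2 (√2) ((2 : ℝ) • e) := by
    simp only [elbowDisc, elbowInner, planeNormSq, real_inner_smul_right,
      real_inner_self_eq_norm_sq, hef.norm_left, real_inner_comm e f, hef.inner_eq_zero, norm_smul]
    norm_num
  obtain ⟨δ₁, hδ₁, hpos, hU⟩ := exists_drawable_elbow hef two_pos (Real.sqrt_pos.2 two_pos)
    (one_pow 2 : (1 : ℝ) ^ 2 = 1) h₀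
  obtain ⟨δ₂, hδ₂, -, hU'⟩ := exists_drawable_elbow hef two_pos (Real.sqrt_pos.2 two_pos)
    (by norm_num : (-1 : ℝ) ^ 2 = 1) h₀
  obtain ⟨δ, hδ, h₁, h₂⟩ : ∃ δ > 0, δ ≤ δ₁ ∧ δ ≤ δ₂ :=
    ⟨min δ₁ δ₂, lt_min hδ₁ hδ₂, min_le_left _ _, min_le_right _ _⟩
  -- The point of the circle that corresponds to `e + t • f` moves by at most `2 * |t|`, which must
  -- stay below `δ`.
  refine ⟨δ / 2, half_pos hδ, ?_⟩
  set C : Set (Unit ⊕ Unit → E) :=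
    {φ | ∀ i, ‖φ i - (fun _ => e) i‖ ≤ Sum.elim (fun _ => δ / 2) (fun _ => δ) i} with hC
  have hCr : Realizable C := realizable_box (Sum.forall.2 ⟨fun _ => half_pos hδ, fun _ => hδ⟩)
  have hCc : IsCompact C := isCompact_box _ _
  have hz : Drawable C fun φ => φ (.inl ()) := hCr.eval _
  have hy : Drawable C fun φ => e + φ (.inr ()) := (hCr.const e).add hef hCc (hCr.eval _)
  have hynear (φ) (hφ : φ ∈ C) : ‖e + φ (.inr ()) - (2 : ℝ) • e‖ ≤ δ := by
    have := hφ (.inr ())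
    rwa [show e + φ (.inr ()) - (2 : ℝ) • e = φ (.inr ()) - e by module]
  have hF := (((hU.comp hCr (f := fun _ φ => e + φ (.inr ())) (fun _ => hy)
    fun φ hφ => (hynear φ hφ).trans h₁).add hef hCc
    (hU'.comp hCr (f := fun _ φ => e + φ (.inr ())) (fun _ => hy)
    fun φ hφ => (hynear φ hφ).trans h₂))).sub hef hCc hy
  -- With `w` on the unit circle of the plane, `e + w` runs on a circle through the origin with
  -- diameter 2, which inversion of power 2 sends to the line `e + ℝ f`.
  have hΓ := (Realizable.setOf_eq hef hCc hz hF).inter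
    ((realizable_sphere_inter (Submodule.span ℝ {e, f}) one_pos).comap
      (fun _ => (Sum.inr () : Unit ⊕ Unit)))
  have hnz (t : ℝ) : ‖e + t • f‖ ^ 2 = 1 + t ^ 2 := by
    simpa using norm_sq_plane hef 1 t
  -- Inversion is an involution, so `w` is recovered analytically from the point on the line.
  refine (hΓ.of_graph (D := {φ : Unit → E | ∃ t : ℝ, |t| ≤ δ / 2 ∧ φ () = e + t • f})
    (γ := fun _ φ => (2 / ‖φ ()‖ ^ 2) • φ () - e) (fun _ => ?_) fun x w => ?_).1
  · intro φ hφ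
    have h₁ : AnalyticAt ℝ (fun φ : Unit → E => φ ()) φ := analyticOnNhd_eval _ () φ hφ
    obtain ⟨t, -, ht⟩ := hφ
    refine AnalyticAt.sub (AnalyticAt.smul ?_ h₁) analyticAt_const
    refine analyticAt_const.div ?_ ?_
    · exact AnalyticAt.comp (g := fun x : E => ‖x‖ ^ 2)
        (contDiff_norm_sq ℝ).contDiffAt.analyticAt h₁
    · simp only [ht, hnz]
      positivity
  · simp only [Set.mem_inter_iff, Set.mem_ofPred_eq, hC, Sum.forall, Sum.elim_inl, Sum.elim_inr,
      Function.comp_apply, Unique.forall_iff]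
    change ((‖x () - e‖ ≤ δ / 2 ∧ ‖w () - e‖ ≤ δ) ∧ _) ∧ ‖w ()‖ = 1 ∧ w () ∈ _ ↔
      (∃ t : ℝ, |t| ≤ δ / 2 ∧ x () = e + t • f) ∧ w () = (2 / ‖x ()‖ ^ 2) • x () - e
    have he : e ∈ Submodule.span ℝ {e, f} := Submodule.subset_span (by simp)
    have hf : f ∈ Submodule.span ℝ {e, f} := Submodule.subset_span (by simp)
    have hdisc (hw : ‖w () - e‖ ≤ δ) : 0 < elbowDisc e f 2 (√2) (e + w ()) :=
      hpos _ (by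
        rw [show e + w () - (2 : ℝ) • e = w () - e by module]
        exact hw.trans h₁)
    constructor
    · rintro ⟨⟨⟨h₃, h₄⟩, h₅⟩, h₆, h₇⟩
      have hy := Submodule.add_mem _ he h₇
      have hp := planeNormSq_pos (hdisc h₄)
      rw [elbow_add_elbow_sub hef hy (hdisc h₄)] at h₅
      obtain ⟨a, b, hab⟩ := Submodule.mem_span_pair.1 hy
      rw [← hab, planeNormSq, inner_left_plane hef, inner_right_plane hef] at hp
      have hw : w () = (a - 1) • e + b • f := by
        rw [sub_smul, one_smul, sub_add_eq_add_sub, hab, add_sub_cancel_left]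
      have hcirc : (a - 1) ^ 2 + b ^ 2 = 1 := by
        rw [← norm_sq_plane hef, ← hw, h₆, one_pow]
      rw [← hab, norm_sq_plane hef] at h₅
      have hN : a ^ 2 + b ^ 2 = 2 * a := by linarith
      have ha : 0 < a := by linarith
      have hx : x () = e + (b / a) • f := by
        rw [h₅, hN]
        match_scalars <;> field_simp
      refine ⟨⟨b / a, ?_, hx⟩, ?_⟩
      · rwa [hx, add_sub_cancel_left, norm_smul, hef.norm_right, mul_one, Real.norm_eq_abs] at h₃
      · rw [hx, hnz, hw]
        have : 1 + (b / a) ^ 2 = 2 / a := by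
          field_simp
          linarith
        rw [this]
        match_scalars <;> field_simp
    · rintro ⟨⟨t, ht, hx⟩, hw⟩
      have hpos' : 0 < 1 + t ^ 2 := by positivity
      rw [hx, hnz] at hw
      have hw' : w () = (2 / (1 + t ^ 2) - 1) • e + (2 * t / (1 + t ^ 2)) • f := by
        rw [hw]
        module
      have hwe : w () - e = (2 / (1 + t ^ 2) - 2) • e + (2 * t / (1 + t ^ 2)) • f := by
        rw [hw]
        module
      have h₄ : ‖w () - e‖ ≤ δ := by
        refine le_trans ?_ (by linarith : 2 * |t| ≤ δ)
        rw [← sq_le_sq₀ (norm_nonneg _) (by positivity), hwe, norm_sq_plane hef, mul_pow, sq_abs]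
        have : (2 / (1 + t ^ 2) - 2) ^ 2 + (2 * t / (1 + t ^ 2)) ^ 2 =
            2 ^ 2 * t ^ 2 / (1 + t ^ 2) := by
          field_simp
          ring
        rw [this, div_le_iff₀ hpos']
        nlinarith [sq_nonneg t, sq_nonneg (t ^ 2)]
      have hws : w () ∈ Submodule.span ℝ {e, f} := Submodule.mem_span_pair.2 ⟨_, _, hw'.symm⟩
      refine ⟨⟨⟨?_, h₄⟩, ?_⟩, ?_, hws⟩
      · rwa [hx, add_sub_cancel_left, norm_smul, hef.norm_right, mul_one, Real.norm_eq_abs]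
      · rw [elbow_add_elbow_sub hef (Submodule.add_mem _ he hws) (hdisc h₄)]
        have hy : e + w () = (2 / (1 + t ^ 2)) • e + (2 * t / (1 + t ^ 2)) • f := by
          rw [hw']
          module
        have : (2 / (1 + t ^ 2)) ^ 2 + (2 * t / (1 + t ^ 2)) ^ 2 = 4 / (1 + t ^ 2) := by
          field_simp
          ring
        rw [hy, norm_sq_plane hef, this, hx]
        match_scalars <;> field_simp <;> ring
      · rw [← sq_eq_sq₀ (norm_nonneg _) zero_le_one, hw', norm_sq_plane hef]
        field_simp
        ring

/-- Scaling by `δ / R` and adding `e` carries this diameter onto the segment already drawn. -/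
theorem OrthonormalPair.realizable_line (hef : OrthonormalPair e f) {R : ℝ} (hR : 0 < R) :
    Realizable {φ : Unit → E | φ () ∈ Submodule.span ℝ {f} ∧ ‖φ ()‖ ≤ R} := by
  obtain ⟨δ, hδ, h⟩ := exists_realizable_segment hef
  have hc : 0 < δ / R := div_pos hδ hR
  have hBr : Realizable {φ : Unit → E | ∀ i, ‖φ i - (fun _ => 0) i‖ ≤ (fun _ => R) i} :=
    realizable_box fun _ => hR
  have hBc := isCompact_box (fun _ : Unit => (0 : E)) fun _ => R
  convert hBr.preimage h (f := fun _ φ => e + (δ / R) • φ ())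
    (fun _ => (hBr.const e).add hef hBc ((hBr.eval ()).const_smul hef hBc _)) using 1
  ext φ
  simp only [Set.mem_ofPred_eq, sub_zero, Unique.forall_iff, add_right_inj,
    Submodule.mem_span_singleton]
  change _ ↔ ‖φ ()‖ ≤ R ∧ _
  rw [and_comm]
  refine and_congr_right fun hφ => ⟨?_, ?_⟩
  · rintro ⟨t, ht⟩
    rw [← ht, norm_smul, hef.norm_right, mul_one, Real.norm_eq_abs] at hφ
    refine ⟨δ / R * t, ?_, by rw [← ht, smul_smul]⟩
    rw [abs_mul, abs_of_pos hc, div_mul_eq_mul_div, div_le_iff₀ hR]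
    exact mul_le_mul_of_nonneg_left hφ hδ.le
  · rintro ⟨t, -, ht⟩
    exact ⟨(δ / R)⁻¹ * t, by rw [mul_smul, ← ht, inv_smul_smul₀ hc.ne']⟩

/-- Elbows and inversors need a plane through the given direction; here dimension at least 2 enters.
-/
theorem exists_orthonormalPair (hE : 2 ≤ Module.finrank ℝ E) {v : E} (hv : ‖v‖ = 1) :
    ∃ e, OrthonormalPair e v := by
  have hv0 : v ≠ 0 := by
    rintro rfl
    simp at hv
  have h := Submodule.finrank_add_finrank_orthogonal (ℝ ∙ v)
  rw [finrank_span_singleton hv0] at h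
  have : Nontrivial (ℝ ∙ v)ᗮ := Module.nontrivial_of_finrank_pos (R := ℝ) (by omega)
  obtain ⟨⟨u, hu⟩, hu0⟩ := exists_ne (0 : (ℝ ∙ v)ᗮ)
  have hu0 : u ≠ 0 := by simpa using hu0
  refine ⟨‖u‖⁻¹ • u, ?_, hv, ?_⟩
  · simp [norm_smul, hu0]
  · rw [real_inner_smul_left, real_inner_comm,
      Submodule.mem_orthogonal_singleton_iff_inner_right.1 hu, mul_zero]

theorem realizable_line (hE : 2 ≤ Module.finrank ℝ E) {v : E} (hv : v ≠ 0) {R : ℝ} (hR : 0 < R) :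
    Realizable {φ : Unit → E | φ () ∈ Submodule.span ℝ {v} ∧ ‖φ ()‖ ≤ R} := by
  obtain ⟨e, he⟩ := exists_orthonormalPair hE (v := ‖v‖⁻¹ • v) (by simp [norm_smul, hv])
  have := he.realizable_line hR
  rwa [Submodule.span_singleton_smul_eq (by simpa using hv)] at this

end Lines

/-! ### Coordinates and arithmetic -/

section Arithmetic

open scoped RealInnerProductSpace

variable {ι : Type} {K E : Type*} [NormedAddCommGroup E] {D : Set (ι → E)}

/-- Inputs in `D` together with further vertices in balls of radius `R` around `0`. -/
def addBalls (K : Type*) (D : Set (ι → E)) (R : ℝ) : Set (ι ⊕ K → E) :=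
  {φ | φ ∘ Sum.inl ∈ D ∧ ∀ k, ‖φ (Sum.inr k)‖ ≤ R}

theorem elim_mem_addBalls {R : ℝ} {x : ι → E} {w : K → E} :
    Sum.elim x w ∈ addBalls K D R ↔ x ∈ D ∧ ∀ k, ‖w k‖ ≤ R :=
  Iff.rfl

variable [InnerProductSpace ℝ E] {e f : E}

theorem IsCompact.addBalls [FiniteDimensional ℝ E] (h : IsCompact D) (R : ℝ) : IsCompact (addBalls K D R) := by
  have hc : Continuous fun p : (ι → E) × (K → E) => (Sum.elim p.1 p.2 : ι ⊕ K → E) := by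
    refine continuous_pi fun i => ?_
    cases i
    · exact (continuous_apply _).comp continuous_fst
    · exact (continuous_apply _).comp continuous_snd
  convert (h.prod (isCompact_box (fun _ : K => (0 : E)) fun _ => R)).image hc using 1
  ext φ
  constructor
  · exact fun hφ => ⟨(φ ∘ Sum.inl, φ ∘ Sum.inr), ⟨hφ.1, by simpa using hφ.2⟩, by simp⟩
  · rintro ⟨⟨x, w⟩, ⟨hx, hw⟩, rfl⟩
    exact ⟨hx, by simpa using hw⟩

variable [Fintype ι]

/-- Vertices to be defined implicitly are confined to balls so that the domain stays compact and
sums remain drawable. -/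
theorem Realizable.addBalls {K : Type} [Fintype K] (h : Realizable D) {R : ℝ} (hR : 0 < R) :
    Realizable (addBalls K D R) := by
  have hb : Realizable {x : ι ⊕ K → E | ∀ k, ‖x (Sum.inr k)‖ ≤ R} := by
    simpa using (realizable_box (c := fun _ : K => (0 : E)) fun _ => hR).comap
      (Sum.inr : K → ι ⊕ K)
  exact (h.comap (Sum.inl : ι → ι ⊕ K)).inter hb

theorem Drawable.comp_inl {K : Type} [Fintype K] {g : (ι → E) → E} (hg : Drawable D g) {R : ℝ}
    (hR : 0 < R) : Drawable (addBalls K D R) fun φ => g (φ ∘ Sum.inl) :=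
  Drawable.comp (hg.realizable.addBalls (K := K) hR) hg (f := fun i φ => φ (Sum.inl i))
    (fun _ => (hg.realizable.addBalls hR).eval _) fun _ hφ => hφ.1

theorem Drawable.analytic_scalar (he : ‖e‖ = 1) {a : (ι → E) → ℝ}
    (ha : Drawable D fun x => a x • e) : AnalyticOnNhd ℝ a D := fun x hx => by
  have := ((innerSL ℝ e).analyticAt _).comp (ha.analytic x hx)
  refine this.congr (.of_forall fun x => ?_)
  change ⟪e, a x • e⟫ = a x
  rw [real_inner_smul_right, real_inner_self_eq_norm_sq, he]
  ring

variable [FiniteDimensional ℝ E]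

/-- The components of a drawable position along an orthonormal basis are drawable. -/
theorem Drawable.component (hE : 2 ≤ Module.finrank ℝ E) (hD : IsCompact D) {J : Type} [Fintype J]
    (b : OrthonormalBasis J ℝ E) {g : (ι → E) → E} (hg : Drawable D g) (j : J) :
    Drawable D fun x => ⟪b j, g x⟫ • b j := by
  obtain ⟨e, hef⟩ := exists_orthonormalPair hE (b.norm_eq_one j)
  obtain ⟨R, hR, hgR⟩ := hg.exists_norm_le hD
  have hCr := hg.realizable.addBalls (K := J) hR
  have hCc := hD.addBalls (K := J) R
  -- Vertices on the coordinate axes with sum `g x` can only be its components.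
  have hΓ := (Realizable.setOf_eq hef hCc (hg.comp_inl hR)
    (hCr.finset_sum hef hCc Finset.univ fun j => hCr.eval (Sum.inr j))).preimage
    (J := J) (D₂ := {ψ | ∀ j, ψ j ∈ Submodule.span ℝ {b j} ∧ ‖ψ j‖ ≤ R}) ?_
    (f := fun j φ => φ (Sum.inr j)) ?_
  · refine (hΓ.of_graph (γ := fun j x => ⟪b j, g x⟫ • b j) (fun j => ?_) fun x w => ?_).2 j
    · refine AnalyticOnNhd.smul (fun x hx => ?_) analyticOnNhd_const
      exact ((innerSL ℝ (b j)).analyticAt _).comp (hg.analytic x hx)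
    · simp only [Set.mem_ofPred_eq, elim_mem_addBalls, Sum.elim_comp_inl, Sum.elim_inr,
        Submodule.mem_span_singleton]
      constructor
      · rintro ⟨⟨⟨hx, -⟩, hw⟩, h⟩
        refine ⟨hx, fun k => ?_⟩
        choose a ha using fun j => (h j).1
        rw [hw, ← ha, inner_sum]
        classical
        simp [← ha, real_inner_smul_right, b.inner_eq_ite]
      · rintro ⟨hx, hw⟩
        have hb k : ‖w k‖ ≤ R := by
          rw [hw, norm_smul, b.norm_eq_one, mul_one]
          refine le_trans ?_ (hgR x hx)
          simpa [b.norm_eq_one] using norm_inner_le_norm (𝕜 := ℝ) (b k) (g x)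
        refine ⟨⟨⟨hx, hb⟩, ?_⟩, fun k => ⟨⟨_, (hw k).symm⟩, hb k⟩⟩
        simp only [hw, b.sum_repr']
  · have h₀ := (IsLinkageSet.univ (V := J) (E := E)).realizable
    simpa using h₀.setOf_forall fun j =>
      h₀.inter ((realizable_line hE (b.orthonormal.ne_zero j) hR).comap fun _ : Unit => j)
  · exact fun i => (hCr.eval _).mono (Realizable.setOf_eq hef hCc (hg.comp_inl hR)
      (hCr.finset_sum hef hCc Finset.univ fun j => hCr.eval (Sum.inr j))) fun φ hφ => hφ.1

/-- Transfer of a scalar between orthogonal directions. -/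
theorem Drawable.transfer (hE : 2 ≤ Module.finrank ℝ E) (hD : IsCompact D) {v w : E}
    (hvw : OrthonormalPair v w) {a : (ι → E) → ℝ} (ha : Drawable D fun x => a x • v) :
    Drawable D fun x => a x • w := by
  obtain ⟨R, hR, haR⟩ := ha.exists_norm_le hD
  have hCr := ha.realizable.addBalls (K := Unit) hR
  have hCc := hD.addBalls (K := Unit) R
  have hR2 : 0 < 2 * R := by positivity
  have hv0 : v ≠ 0 := fun h => by simpa [h] using hvw.norm_left
  have hw0 : w ≠ 0 := fun h => by simpa [h] using hvw.norm_right
  have hsub : v - w ≠ 0 := fun h => by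
    have := hvw.inner_eq_zero
    rw [sub_eq_zero.1 h, real_inner_self_eq_norm_sq, hvw.norm_right] at this
    norm_num at this
  -- The new vertex is the intersection of the axis of `w` with the line through `a x • v` parallel
  -- to `v - w`.
  have hΓ := (hCr.preimage (realizable_line hE hw0 hR) (f := fun _ φ => φ (Sum.inr ()))
    fun _ => hCr.eval _).inter (hCr.preimage (realizable_line hE hsub hR2)
    (f := fun _ φ => a (φ ∘ Sum.inl) • v - φ (Sum.inr ()))
    fun _ => (ha.comp_inl hR).sub hvw hCc (hCr.eval _))
  have hin (x) : ⟪v, a x • v⟫ = a x := by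
    rw [real_inner_smul_right, real_inner_self_eq_norm_sq, hvw.norm_left]
    ring
  refine (hΓ.of_graph (γ := fun _ x => a x • w) (fun _ => ?_) fun x u => ?_).2 ()
  · refine AnalyticOnNhd.smul (fun x hx => ?_) analyticOnNhd_const
    have := ((innerSL ℝ v).analyticAt _).comp (ha.analytic x hx)
    exact this.congr (.of_forall fun x => hin x)
  · simp only [Set.mem_inter_iff, Set.mem_ofPred_eq, elim_mem_addBalls, Sum.elim_comp_inl,
      Sum.elim_inr, Submodule.mem_span_singleton, Unique.forall_iff]
    change ((x ∈ D ∧ ‖u ()‖ ≤ R) ∧ (∃ c : ℝ, c • w = u ()) ∧ _) ∧ (x ∈ D ∧ ‖u ()‖ ≤ R) ∧ _ ↔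
      x ∈ D ∧ u () = a x • w
    constructor
    · rintro ⟨⟨⟨hx, -⟩, ⟨s, hs⟩, -⟩, -, ⟨t, ht⟩, -⟩
      refine ⟨hx, ?_⟩
      rw [← hs] at ht ⊢
      have h₁ := congrArg (fun z => ⟪v, z⟫) ht
      have h₂ := congrArg (fun z => ⟪w, z⟫) ht
      simp only [inner_sub_right, real_inner_smul_right, real_inner_self_eq_norm_sq,
        hvw.norm_left, hvw.norm_right, real_inner_comm v w, hvw.inner_eq_zero] at h₁ h₂
      congr 1
      linarith
    · rintro ⟨hx, hu⟩
      have h := haR x hx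
      rw [norm_smul, hvw.norm_left, mul_one] at h
      have h' : ‖u ()‖ ≤ R := by rwa [hu, norm_smul, hvw.norm_right, mul_one]
      refine ⟨⟨⟨hx, h'⟩, ⟨_, hu.symm⟩, h'⟩, ⟨hx, h'⟩, ⟨a x, ?_⟩, ?_⟩
      · rw [hu, smul_sub]
      · refine (norm_sub_le _ _).trans ?_
        have := haR x hx
        linarith

/-- Inversion of a scalar near `1`. -/
theorem Drawable.inv_smul (hE : 2 ≤ Module.finrank ℝ E) (hef : OrthonormalPair e f)
    (hD : IsCompact D) {a : (ι → E) → ℝ} (ha : Drawable D fun x => a x • e)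
    (ha1 : ∀ x ∈ D, |a x - 1| ≤ 1 / 4) : Drawable D fun x => (a x)⁻¹ • e := by
  have hCr := ha.realizable.addBalls (K := Fin 2) two_pos
  have hCc := hD.addBalls (K := Fin 2) 2
  have he0 : e ≠ 0 := fun h => by simpa [h] using hef.norm_left
  have hf0 : f ≠ 0 := fun h => by simpa [h] using hef.norm_right
  -- New vertices `q • e` and `r • f` satisfy `((q - a) / 2) ^ 2 + r ^ 2 = 1` and `((q + a) / 2) ^ 2
  -- + r ^ 2 = 2`; subtraction gives `q * a = 1`. The cable to `f` selects the positive `r`.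
  have hq := (hCr.eval (Sum.inr 0)).const_smul hef hCc (1 / 2)
  have hp := (ha.comp_inl (K := Fin 2) two_pos).const_smul hef hCc (1 / 2)
  have hs := (hCr.eval (Sum.inr 1)).add hef hCc (hq.sub hef hCc hp)
  have ht := (hCr.eval (Sum.inr 1)).add hef hCc (hq.add hef hCc hp)
  have hΓ := ((((hCr.preimage (realizable_line hE he0 two_pos) (f := fun _ φ => φ (Sum.inr 0))
    fun _ => hCr.eval _).inter (hCr.preimage (realizable_line hE hf0 two_pos)
    (f := fun _ φ => φ (Sum.inr 1)) fun _ => hCr.eval _)).inter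
    (Realizable.setOf_norm_sub_eq hs (hCr.const 0) one_pos)).inter
    (Realizable.setOf_norm_sub_eq ht (hCr.const 0) (Real.sqrt_pos.2 two_pos))).inter
    (Realizable.setOf_norm_sub_le (hCr.eval (Sum.inr 1)) (hCr.const f) one_half_pos)
  have haa := ha.analytic_scalar hef.norm_left
  have hbound (x) (hx : x ∈ D) : 3 / 4 ≤ a x ∧ a x ≤ 5 / 4 := by
    have := abs_le.1 (ha1 x hx)
    constructor <;> linarith
  have hinv (x) (hx : x ∈ D) : 0 < (a x)⁻¹ ∧ (a x)⁻¹ ≤ 4 / 3 := by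
    obtain ⟨h₁, h₂⟩ := hbound x hx
    refine ⟨inv_pos.2 (by linarith), ?_⟩
    rw [inv_le_comm₀ (by linarith) (by norm_num)]
    linarith
  -- The lower bound gives `r ≥ 1 / 2`, within reach of the cable of length 1/2 to `f`, and keeps
  -- the square root analytic.
  have hdisc (x) (hx : x ∈ D) : 1 / 4 ≤ 1 - ((a x)⁻¹ - a x) ^ 2 / 4 ∧
      1 - ((a x)⁻¹ - a x) ^ 2 / 4 ≤ 1 := by
    obtain ⟨h₁, h₂⟩ := hbound x hx
    obtain ⟨h₃, h₄⟩ := hinv x hx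
    have : |(a x)⁻¹ - a x| ≤ 5 / 4 := abs_le.2 ⟨by linarith, by linarith⟩
    have := sq_le_sq' (abs_le.1 this).1 (abs_le.1 this).2
    constructor <;> nlinarith [sq_nonneg ((a x)⁻¹ - a x)]
  refine (hΓ.of_graph (D := D)
    (γ := ![fun x => (a x)⁻¹ • e, fun x => √(1 - ((a x)⁻¹ - a x) ^ 2 / 4) • f])
    (Fin.forall_fin_two.2 ⟨?_, ?_⟩) fun x w => ?_).2 0
  · exact (haa.inv fun x hx => by linarith [(hbound x hx).1]).smul analyticOnNhd_const
  · refine AnalyticOnNhd.smul (fun x hx => ?_) analyticOnNhd_const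
    have h₁ : AnalyticAt ℝ (fun x => (a x)⁻¹) x :=
      (haa x hx).inv (by linarith [(hbound x hx).1])
    have h₂ : AnalyticAt ℝ (fun x => 1 - ((a x)⁻¹ - a x) ^ 2 / 4) x :=
      analyticAt_const.sub (((h₁.sub (haa x hx)).pow 2).div_const)
    exact AnalyticAt.comp (g := Real.sqrt)
      (Real.contDiffAt_sqrt (n := ⊤) (by linarith [(hdisc x hx).1])).analyticAt h₂
  · simp only [Set.mem_inter_iff, Set.mem_ofPred_eq, elim_mem_addBalls, Sum.elim_comp_inl,
      Sum.elim_inr, Submodule.mem_span_singleton, Fin.forall_fin_two, sub_zero,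
      Matrix.cons_val_zero, Matrix.cons_val_one]
    have hform (q r p : ℝ) : r • f + ((1 / 2 : ℝ) • q • e - (1 / 2 : ℝ) • p • e) =
        ((q - p) / 2) • e + r • f := by module
    have hform' (q r p : ℝ) : r • f + ((1 / 2 : ℝ) • q • e + (1 / 2 : ℝ) • p • e) =
        ((q + p) / 2) • e + r • f := by module
    constructor
    · rintro ⟨⟨⟨⟨⟨⟨hx, -⟩, ⟨q, hq⟩, -⟩, -, ⟨r, hr⟩, -⟩, -, h₁⟩, -, h₂⟩, -, h₃⟩
      rw [← hq, ← hr, hform] at h₁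
      rw [← hq, ← hr, hform'] at h₂
      have h₁' := congrArg (· ^ 2) h₁
      have h₂' := congrArg (· ^ 2) h₂
      simp only [norm_sq_plane hef, Real.sq_sqrt zero_le_two] at h₁' h₂'
      have hqa : q = (a x)⁻¹ := eq_inv_of_mul_eq_one_left (by linarith)
      have hr0 : 0 ≤ r := by
        rw [← hr, show r • f - f = (r - 1) • f by module, norm_smul, hef.norm_right, mul_one,
          Real.norm_eq_abs] at h₃
        linarith [(abs_le.1 h₃).1]
      refine ⟨hx, by rw [← hq, hqa], ?_⟩
      rw [← hr, ← hqa, show 1 - (q - a x) ^ 2 / 4 = r ^ 2 by linarith, Real.sqrt_sq hr0]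
    · rintro ⟨hx, hq, hr⟩
      obtain ⟨h₁, h₂⟩ := hdisc x hx
      obtain ⟨h₃, h₄⟩ := hinv x hx
      have hmul : (a x)⁻¹ * a x = 1 := inv_mul_cancel₀ (by linarith [(hbound x hx).1])
      have hs2 := Real.sq_sqrt (by linarith : 0 ≤ 1 - ((a x)⁻¹ - a x) ^ 2 / 4)
      have hs1 : √(1 - ((a x)⁻¹ - a x) ^ 2 / 4) ≤ 1 := Real.sqrt_le_one.2 h₂
      have hs0 : 1 / 2 ≤ √(1 - ((a x)⁻¹ - a x) ^ 2 / 4) := Real.le_sqrt_of_sq_le (by linarith)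
      generalize √(1 - ((a x)⁻¹ - a x) ^ 2 / 4) = s at *
      have hw0 : ‖w 0‖ ≤ 2 := by
        rw [hq, norm_smul, hef.norm_left, mul_one, Real.norm_of_nonneg h₃.le]
        linarith
      have hw1 : ‖w 1‖ ≤ 2 := by
        rw [hr, norm_smul, hef.norm_right, mul_one, Real.norm_of_nonneg (by linarith)]
        linarith
      have hC : x ∈ D ∧ ‖w 0‖ ≤ 2 ∧ ‖w 1‖ ≤ 2 := ⟨hx, hw0, hw1⟩
      refine ⟨⟨⟨⟨⟨hC, ⟨_, hq.symm⟩, hw0⟩, hC, ⟨_, hr.symm⟩, hw1⟩, hC, ?_⟩, hC, ?_⟩, hC, ?_⟩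
      · rw [hq, hr, hform, ← sq_eq_sq₀ (norm_nonneg _) zero_le_one, norm_sq_plane hef]
        linarith
      · rw [hq, hr, hform', ← sq_eq_sq₀ (norm_nonneg _) (Real.sqrt_nonneg _), norm_sq_plane hef,
          Real.sq_sqrt zero_le_two]
        linarith
      · rw [hr, show s • f - f = (s - 1) • f by module, norm_smul, hef.norm_right, mul_one,
          Real.norm_eq_abs, abs_le]
        constructor <;> linarith

end Arithmetic

/-! ### Polynomial functions -/

section Polynomials

open scoped RealInnerProductSpace

theorem IsPolynomialFunction.comp_linearMap {E F : Type*} [AddCommGroup E] [Module ℝ E]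
    [AddCommGroup F] [Module ℝ F] {p : F → ℝ} (hp : IsPolynomialFunction p) (g : E →ₗ[ℝ] F) :
    IsPolynomialFunction fun x => p (g x) := by
  obtain ⟨P, hP⟩ := hp
  refine ⟨MvPolynomial.rename (fun l => l ∘ₗ g) P, fun x => ?_⟩
  refine (hP _).trans ?_
  rw [MvPolynomial.eval_rename]
  rfl

variable {ι : Type} {E : Type*} [Fintype ι] [NormedAddCommGroup E] [InnerProductSpace ℝ E]
  [FiniteDimensional ℝ E] {D : Set (ι → E)} {e f : E} {a b : (ι → E) → ℝ}

namespace Drawable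

/-- Squares come from reciprocals: the mean of 1/(1 - y) and 1/(1 + y) is 1/(1 - y²), and one more
reciprocal gives 1 - y². The scaling `y = a / (8 * R)` keeps every argument within 1/4 of 1. -/
theorem sq_smul (hE : 2 ≤ Module.finrank ℝ E) (hef : OrthonormalPair e f) (hD : IsCompact D)
    (ha : Drawable D fun x => a x • e) : Drawable D fun x => (a x ^ 2) • e := by
  obtain ⟨R, hR, haR⟩ := ha.exists_norm_le hD
  have hc := ha.realizable.const e
  have hy (x) (hx : x ∈ D) : |(8 * R)⁻¹ * a x| ≤ 1 / 8 := by
    have := haR x hx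
    rw [norm_smul, hef.norm_left, mul_one, Real.norm_eq_abs] at this
    rw [abs_mul, abs_of_pos (by positivity), inv_mul_le_iff₀ (by positivity)]
    linarith
  have hu : Drawable D fun x => (1 - (8 * R)⁻¹ * a x) • e :=
    (hc.sub hef hD (ha.const_smul hef hD (8 * R)⁻¹)).congr_fun fun x => by module
  have hv : Drawable D fun x => (1 + (8 * R)⁻¹ * a x) • e :=
    (hc.add hef hD (ha.const_smul hef hD (8 * R)⁻¹)).congr_fun fun x => by module
  have hu' := hu.inv_smul hE hef hD fun x hx => by
    rw [sub_sub_cancel_left, abs_neg]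
    exact (hy x hx).trans (by norm_num)
  have hv' := hv.inv_smul hE hef hD fun x hx => by
    rw [add_sub_cancel_left]
    exact (hy x hx).trans (by norm_num)
  have hs : Drawable D fun x => ((1 / 2) *
      ((1 - (8 * R)⁻¹ * a x)⁻¹ + (1 + (8 * R)⁻¹ * a x)⁻¹)) • e :=
    ((hu'.add hef hD hv').const_smul hef hD (1 / 2)).congr_fun fun x => by module
  have hsx (y : ℝ) (hy : |y| ≤ 1 / 8) :
      (1 / 2) * ((1 - y)⁻¹ + (1 + y)⁻¹) = (1 - y ^ 2)⁻¹ := by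
    have h₁ : 1 - y ≠ 0 := by linarith [(abs_le.1 hy).2]
    have h₂ : 1 + y ≠ 0 := by linarith [(abs_le.1 hy).1]
    have h₃ : 1 - y ^ 2 ≠ 0 := by
      rw [show 1 - y ^ 2 = (1 - y) * (1 + y) by ring]
      exact mul_ne_zero h₁ h₂
    field_simp
    ring
  have hs' := hs.inv_smul hE hef hD fun x hx => by
    rw [hsx _ (hy x hx)]
    have := sq_le_sq' (abs_le.1 (hy x hx)).1 (abs_le.1 (hy x hx)).2
    generalize (8 * R)⁻¹ * a x = y at *
    have h₁ : 0 < 1 - y ^ 2 := by linarith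
    rw [inv_eq_one_div, div_sub_one h₁.ne', abs_of_nonneg
      (div_nonneg (by linarith [sq_nonneg y]) h₁.le), div_le_iff₀ h₁]
    linarith
  refine ((hc.sub hef hD hs').const_smul hef hD ((8 * R) ^ 2)).congr
    (((ha.analytic_scalar hef.norm_left).pow 2).smul analyticOnNhd_const) fun x hx => ?_
  rw [hsx _ (hy x hx), inv_inv]
  match_scalars
  field_simp
  ring

/-- Polarization. -/
theorem mul_smul (hE : 2 ≤ Module.finrank ℝ E) (hef : OrthonormalPair e f) (hD : IsCompact D)
    (ha : Drawable D fun x => a x • e) (hb : Drawable D fun x => b x • e) :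
    Drawable D fun x => (a x * b x) • e := by
  have hs : Drawable D fun x => (a x + b x) • e :=
    (ha.add hef hD hb).congr_fun fun x => by module
  have ht : Drawable D fun x => (a x - b x) • e :=
    (ha.sub hef hD hb).congr_fun fun x => by module
  exact (((hs.sq_smul hE hef hD).sub hef hD (ht.sq_smul hE hef hD)).const_smul hef hD
    (1 / 4)).congr_fun fun x => by module

end Drawable

theorem Realizable.eval_smul (hE : 2 ≤ Module.finrank ℝ E) (hef : OrthonormalPair e f)
    (hD : IsCompact D) (hr : Realizable D) {σ : Type*} {l : σ → (ι → E) → ℝ}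
    (hl : ∀ i, Drawable D fun x => l i x • e) (p : MvPolynomial σ ℝ) :
    Drawable D fun x => (MvPolynomial.eval (fun i => l i x) p) • e := by
  induction p using MvPolynomial.induction_on with
  | C c => simpa using hr.const (c • e)
  | add p q hp hq => simpa [add_smul] using hp.add hef hD hq
  | mul_X p i hp => simpa using hp.mul_smul hE hef hD (hl i)

/-- All coordinates of all inputs are carried to the single axis `b j₀`, where they can be combined.
-/
theorem Realizable.dual_smul (hE : 2 ≤ Module.finrank ℝ E) (hD : IsCompact D) (hr : Realizable D)
    {J : Type} [Fintype J] (b : OrthonormalBasis J ℝ E) (j₀ : J) (l : Module.Dual ℝ (ι → E)) :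
    Drawable D fun x => l x • b j₀ := by
  classical
  obtain ⟨e, hef⟩ := exists_orthonormalPair hE (b.norm_eq_one j₀)
  have hcoord (i : ι) (j : J) : Drawable D fun x => ⟪b j, x i⟫ • b j₀ := by
    rcases eq_or_ne j j₀ with rfl | hj
    · exact (hr.eval i).component hE hD b j
    · exact ((hr.eval i).component hE hD b j).transfer hE hD
        ⟨b.norm_eq_one j, b.norm_eq_one j₀, b.orthonormal.2 hj⟩
  refine (hr.finset_sum hef hD Finset.univ fun i => hr.finset_sum hef hD Finset.univ fun j =>
    (hcoord i j).const_smul hef hD (l (Pi.single i (b j)))).congr_fun fun x => ?_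
  have hx : l x = ∑ i, ∑ j, l (Pi.single i (b j)) * ⟪b j, x i⟫ := by
    conv_lhs => rw [← Finset.univ_sum_single x, map_sum]
    refine Finset.sum_congr rfl fun i _ => ?_
    conv_lhs => rw [← b.sum_repr' (x i), ← LinearMap.single_apply (R := ℝ), map_sum, map_sum]
    refine Finset.sum_congr rfl fun j _ => ?_
    rw [map_smul, map_smul, smul_eq_mul, mul_comm, LinearMap.single_apply]
  rw [hx, Finset.sum_smul]
  refine Finset.sum_congr rfl fun i _ => ?_
  rw [Finset.sum_smul]
  exact Finset.sum_congr rfl fun j _ => smul_smul _ _ _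

theorem IsPolynomialFunction.drawable (hE : 2 ≤ Module.finrank ℝ E) (hD : IsCompact D)
    (hr : Realizable D) {J : Type} [Fintype J] (b : OrthonormalBasis J ℝ E) (j₀ : J)
    {p : (ι → E) → ℝ} (hp : IsPolynomialFunction p) : Drawable D fun x => p x • b j₀ := by
  obtain ⟨e, hef⟩ := exists_orthonormalPair hE (b.norm_eq_one j₀)
  obtain ⟨P, hP⟩ := hp
  exact (hr.eval_smul hE hef.symm hD (l := fun l x => l x) (hr.dual_smul hE hD b j₀) P).congr_fun
    fun x => by rw [hP]

/-- The part of a compact realizable set cut out by polynomial equations and inequalities is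
realizable. -/
theorem Realizable.setOf_polynomial (hE : 2 ≤ Module.finrank ℝ E) (hD : IsCompact D)
    (hr : Realizable D) {m k : ℕ} {p : Fin m → (ι → E) → ℝ} {q : Fin k → (ι → E) → ℝ}
    (hp : ∀ i, IsPolynomialFunction (p i)) (hq : ∀ j, IsPolynomialFunction (q j)) :
    Realizable {x | x ∈ D ∧ (∀ i, p i x = 0) ∧ ∀ j, 0 ≤ q j x} := by
  let b := stdOrthonormalBasis ℝ E
  let j₀ : Fin (Module.finrank ℝ E) := ⟨0, by omega⟩
  obtain ⟨e, hef⟩ := exists_orthonormalPair hE (b.norm_eq_one j₀)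
  have hb : b j₀ ≠ 0 := b.orthonormal.ne_zero j₀
  have h₁ : Realizable {x | x ∈ D ∧ ∀ i, p i x = 0} := by
    refine hr.setOf_forall fun i => ?_
    simpa [hb] using Realizable.setOf_eq hef hD ((hp i).drawable hE hD hr b j₀) (hr.const 0)
  have h₂ : Realizable {x | x ∈ D ∧ ∀ j, 0 ≤ q j x} := by
    refine hr.setOf_forall fun j => ?_
    have hd := (hq j).drawable hE hD hr b j₀
    obtain ⟨M, hM, hqM⟩ := hd.exists_norm_le hD
    -- Since `|q| ≤ M` on `D`, the condition `0 ≤ q` is the same as `|q - M| ≤ M`, a cable.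
    convert Realizable.setOf_norm_sub_le hd (hr.const (M • b j₀)) hM using 1
    ext x
    refine and_congr_right fun hx => ?_
    have := hqM x hx
    rw [norm_smul, b.norm_eq_one, mul_one, Real.norm_eq_abs, abs_le] at this
    rw [← sub_smul, norm_smul, b.norm_eq_one, mul_one, Real.norm_eq_abs, abs_le]
    constructor
    · intro h
      constructor <;> linarith
    · intro h
      linarith [h.1]
  convert h₁.inter h₂ using 1
  ext x
  simp only [Set.mem_inter_iff, Set.mem_ofPred_eq]
  tauto

end Polynomials

/-! ### Realization -/

section Realization

open scoped RealInnerProductSpace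

theorem IsLinkageSet.exists_cabledLinkage_of_nontrivial {n : ℕ} {V : Type*} [Nontrivial V]
    {S : Set (V → EuclideanSpace ℝ (Fin n))} (hS : IsLinkageSet S) :
    ∃ L : CabledLinkage n V, L.configSpace = S := by
  rcases S.eq_empty_or_nonempty with rfl | hne
  · obtain ⟨v, w, hvw⟩ := exists_pair_ne V
    -- All vertices are fixed at 0 and yet joined by bars of length 1, which is contradictory once
    -- there are two vertices.
    refine ⟨⟨⊤, fun _ => 1, fun _ => one_pos, Set.univ, fun _ => 0, ∅⟩, ?_⟩
    refine Set.eq_empty_iff_forall_notMem.2 fun φ hφ => ?_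
    have h₁ := hφ.1 ⟨v, trivial⟩
    have h₂ := hφ.1 ⟨w, trivial⟩
    have h₃ := (hφ.2 v w hvw).2 (Set.notMem_empty _)
    simp only at h₁ h₂ h₃
    rw [h₁, h₂, sub_zero, norm_zero] at h₃
    exact zero_ne_one h₃
  · exact hS.exists_cabledLinkage hne

variable {A B : Type*} [NormedAddCommGroup A] [NormedSpace ℝ A] [NormedAddCommGroup B]
  [NormedSpace ℝ B]

theorem AnalyticOnNhd.isAnalyticRestriction [CompleteSpace B] {X : Set A} {g : A → B}
    (hg : AnalyticOnNhd ℝ g X) : IsAnalyticRestriction fun x : X => g x :=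
  ⟨{x | AnalyticAt ℝ g x}, g, isOpen_analyticAt ℝ g, hg, fun _ hx => hx, fun _ => rfl⟩

theorem exists_isAnalyticIsomorphism [CompleteSpace A] [CompleteSpace B] {X : Set A} {Y : Set B}
    {g : A → B} {h : B → A} (hg : AnalyticOnNhd ℝ g X) (hh : AnalyticOnNhd ℝ h Y)
    (hgY : ∀ x ∈ X, g x ∈ Y) (hhX : ∀ y ∈ Y, h y ∈ X) (hhg : ∀ x ∈ X, h (g x) = x)
    (hgh : ∀ y ∈ Y, g (h y) = y) :
    ∃ f : X ≃ₜ Y, IsAnalyticIsomorphism f ∧ ∀ x, (f x : B) = g x :=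
  ⟨{ toFun := fun x => ⟨g x, hgY x x.2⟩
     invFun := fun y => ⟨h y, hhX y y.2⟩
     left_inv := fun x => Subtype.ext (hhg x x.2)
     right_inv := fun y => Subtype.ext (hgh y y.2)
     continuous_toFun := (continuousOn_iff_continuous_domRestrict.1 hg.continuousOn).subtype_mk _
     continuous_invFun := (continuousOn_iff_continuous_domRestrict.1 hh.continuousOn).subtype_mk _ },
    ⟨hg.isAnalyticRestriction, hh.isAnalyticRestriction⟩, fun _ => rfl⟩

theorem IsAnalyticIsomorphism.symm {X : Set A} {Y : Set B} {f : X ≃ₜ Y}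
    (hf : IsAnalyticIsomorphism f) : IsAnalyticIsomorphism f.symm :=
  ⟨hf.2, hf.1⟩

/-- A realizable set times `k` free vertices, as the graph of an analytic map. -/
theorem Realizable.exists_graph {E : Type*} [NormedAddCommGroup E] [NormedSpace ℝ E] {s : ℕ}
    {X : Set (Fin s → E)} (hX : Realizable X) (k : ℕ) :
    ∃ (m : ℕ) (S : Set (Fin s ⊕ Fin m → E)) (G : (Fin s → E) × (Fin k → E) → Fin m → E)
      (r : Fin k → Fin m), 2 ≤ m ∧ IsLinkageSet S ∧ AnalyticOnNhd ℝ G (X ×ˢ Set.univ) ∧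
      (∀ x w, Sum.elim x w ∈ S ↔ x ∈ X ∧ w = G (x, w ∘ r)) ∧ ∀ x y, G (x, y) ∘ r = y := by
  obtain ⟨κ, hκ, S, α, hS⟩ := hX
  have := Fintype.ofFinite κ
  -- The `Fin k` vertices are unconstrained. The `Fin 2` vertices, fixed at 0, only guarantee two
  -- vertices, so that an empty set can be realized too.
  let i : ((κ ⊕ Fin k) ⊕ Fin 2) ≃ Fin (Fintype.card ((κ ⊕ Fin k) ⊕ Fin 2)) :=
    Fintype.equivFin _
  let G : (Fin s → E) × (Fin k → E) → (κ ⊕ Fin k) ⊕ Fin 2 → E := fun z =>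
    Sum.elim (Sum.elim (fun j => α j z.1) z.2) 0
  refine ⟨_, {φ | φ ∘ Sum.map id (i ∘ Sum.inl ∘ Sum.inl) ∈ S ∧
    ∀ j, φ (Sum.inr (i (Sum.inr j))) = 0}, fun z => G z ∘ i.symm, i ∘ Sum.inl ∘ Sum.inr,
    by simp, (hS.isLinkageSet.comap _).inter (.setOf_forall fun j => .fix _ _), ?_,
    fun x w => ?_, fun x y => ?_⟩
  · refine AnalyticOnNhd.pi fun j => ?_
    obtain ⟨j, rfl⟩ := i.surjective j
    simp only [Function.comp_apply, Equiv.symm_apply_apply]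
    rcases j with (j | j) | j
    · exact (hS.analytic j).comp analyticOnNhd_fst fun z hz => hz.1
    · exact (analyticOnNhd_eval Set.univ j).comp analyticOnNhd_snd fun z _ => trivial
    · exact analyticOnNhd_const
  · have h := hS.mem_iff x (w ∘ i ∘ Sum.inl ∘ Sum.inl)
    rw [Equiv.eq_comp_symm]
    simp only [Set.mem_ofPred_eq, Sum.elim_comp_map, Function.comp_id, h, funext_iff, Sum.forall, G, Function.comp_apply, Sum.elim_inl, Sum.elim_inr, and_assoc,
      implies_true, true_and, Pi.zero_apply]
  · funext j
    simp [G]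

variable {n : ℕ}

theorem Realizable.exists_cabledLinkage_graph {s : ℕ}
    {X : Set (Fin s → EuclideanSpace ℝ (Fin n))} (hX : Realizable X) (k : ℕ) :
    ∃ (m : ℕ) (L : CabledLinkage n (Fin s ⊕ Fin m))
      (α : timesEuclidean X n k → (Fin m → EuclideanSpace ℝ (Fin n))),
      IsAnalyticRestriction α ∧
      L.configSpace = {φ | ∃ z : timesEuclidean X n k, φ = Sum.elim z.1.1 (α z)} ∧
      ∃ f : timesEuclidean X n k ≃ₜ L.configSpace, IsAnalyticIsomorphism f ∧
        ∀ z, (f z : Fin s ⊕ Fin m → EuclideanSpace ℝ (Fin n)) = Sum.elim z.1.1 (α z) := by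
  obtain ⟨m, S, G, r, hm, hS, hG, hmem, hr⟩ := hX.exists_graph k
  have : Nontrivial (Fin s ⊕ Fin m) :=
    ⟨.inr ⟨0, by omega⟩, .inr ⟨1, by omega⟩, by simp⟩
  obtain ⟨L, hL⟩ := hS.exists_cabledLinkage_of_nontrivial
  have hGS (z) (hz : z ∈ timesEuclidean X n k) : Sum.elim z.1 (G z) ∈ L.configSpace := by
    rw [hL, hmem]
    exact ⟨hz.1, by rw [hr]⟩
  refine ⟨m, L, fun z => G z, hG.isAnalyticRestriction, ?_, ?_⟩
  · ext φ
    constructor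
    · intro hφ
      rw [hL, ← Sum.elim_comp_inl_inr φ, hmem] at hφ
      refine ⟨⟨(φ ∘ Sum.inl, (φ ∘ Sum.inr) ∘ r), hφ.1, trivial⟩, ?_⟩
      change φ = Sum.elim (φ ∘ Sum.inl) (G _)
      rw [← hφ.2, Sum.elim_comp_inl_inr]
    · rintro ⟨z, rfl⟩
      exact hGS z z.2
  · refine exists_isAnalyticIsomorphism
      (g := fun z : (Fin s → EuclideanSpace ℝ (Fin n)) × _ => Sum.elim z.1 (G z))
      (h := fun φ => (fun i => φ (Sum.inl i), fun i => φ (Sum.inr (r i)))) ?_ ?_ hGS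
      (fun φ hφ => ?_) (fun z _ => ?_) fun φ hφ => ?_
    · refine AnalyticOnNhd.pi (Sum.forall.2 ⟨fun i => ?_, fun i => ?_⟩)
      · exact (analyticOnNhd_eval Set.univ i).comp analyticOnNhd_fst fun z _ => trivial
      · exact (analyticOnNhd_eval Set.univ i).comp hG fun z _ => trivial
    · exact (AnalyticOnNhd.pi fun i => analyticOnNhd_eval _ _).prod
        (AnalyticOnNhd.pi fun i => analyticOnNhd_eval _ _)
    · rw [hL, ← Sum.elim_comp_inl_inr φ, hmem] at hφ
      exact ⟨hφ.1, trivial⟩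
    · exact Prod.ext rfl (hr z.1 z.2)
    · rw [hL, ← Sum.elim_comp_inl_inr φ, hmem] at hφ
      change Sum.elim (φ ∘ Sum.inl) (G _) = φ
      rw [← Function.comp_def, ← Function.comp_def]
      exact (congrArg _ hφ.2.symm).trans (Sum.elim_comp_inl_inr φ)

theorem IsQuasialgebraic.realizable {E : Type*} [NormedAddCommGroup E] [InnerProductSpace ℝ E]
    [FiniteDimensional ℝ E] (hE : 2 ≤ Module.finrank ℝ E) {ι : Type} [Fintype ι]
    {X : Set (ι → E)} (hX : IsQuasialgebraic X) (hc : IsCompact X) : Realizable X := by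
  obtain ⟨a, b, p, q, hp, hq, rfl⟩ := hX
  obtain ⟨R, hR⟩ := hc.isBounded.exists_norm_le
  have hR' : 0 < max R 1 := lt_max_of_lt_right one_pos
  convert (realizable_box (c := fun _ : ι => (0 : E)) fun _ => hR').setOf_polynomial hE
    (isCompact_box _ _) hp hq using 1
  ext x
  refine ⟨fun hx => ⟨fun i => ?_, hx⟩, fun hx => hx.2⟩
  rw [sub_zero]
  exact ((norm_le_pi_norm x i).trans (hR x hx)).trans (le_max_left _ _)

/-- The coordinates in direction `e` of a family of vectors. -/
noncomputable def innerCoords {E : Type*} [NormedAddCommGroup E] [InnerProductSpace ℝ E] (d : ℕ)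
    (e : E) : (Fin d → E) →L[ℝ] EuclideanSpace ℝ (Fin d) :=
  (EuclideanSpace.equiv (Fin d) ℝ).symm.toContinuousLinearMap ∘L
    ContinuousLinearMap.pi fun i => innerSL ℝ e ∘L ContinuousLinearMap.proj i

/-- The family of multiples of `e` with given coefficients. -/
noncomputable def smulCoords {E : Type*} [NormedAddCommGroup E] [InnerProductSpace ℝ E] (d : ℕ)
    (e : E) : EuclideanSpace ℝ (Fin d) →L[ℝ] (Fin d → E) :=
  ContinuousLinearMap.pi fun i => (EuclideanSpace.proj i).smulRight e

/-! ### Encoding ℝᵈ by `d` vertices on a line -/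

section Coords

variable {E : Type*} [NormedAddCommGroup E] [InnerProductSpace ℝ E] {d : ℕ} {e : E}

theorem innerCoords_apply (φ : Fin d → E) (i : Fin d) : innerCoords d e φ i = ⟪e, φ i⟫ :=
  rfl

theorem smulCoords_apply (x : EuclideanSpace ℝ (Fin d)) (i : Fin d) :
    smulCoords d e x i = x i • e :=
  rfl

theorem innerCoords_smulCoords (he : ‖e‖ = 1) (x : EuclideanSpace ℝ (Fin d)) :
    innerCoords d e (smulCoords d e x) = x := by
  ext i
  simp [innerCoords_apply, smulCoords_apply, real_inner_smul_right, he]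

/-- This is the copy of `X` under `smulCoords`: its equations are pulled back along `innerCoords`,
and every vertex is kept on the axis of `e`. -/
theorem realizable_image_smulCoords [FiniteDimensional ℝ E] (hE : 2 ≤ Module.finrank ℝ E)
    (he : ‖e‖ = 1) {X : Set (EuclideanSpace ℝ (Fin d))} (hX : IsQuasialgebraic X)
    (hc : IsCompact X) : Realizable {φ : Fin d → E |
      innerCoords d e φ ∈ X ∧ smulCoords d e (innerCoords d e φ) = φ} := by
  obtain ⟨a, b, p, q, hp, hq, rfl⟩ := hX
  obtain ⟨R, hR⟩ := hc.isBounded.exists_norm_le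
  have hR' : 0 < max R 1 := lt_max_of_lt_right one_pos
  have h₀ := (IsLinkageSet.univ (V := Fin d) (E := E)).realizable
  have he0 : e ≠ 0 := fun h => by simp [h] at he
  have h₁ := (realizable_box (c := fun _ : Fin d => (0 : E)) fun _ => hR').setOf_polynomial hE
    (isCompact_box _ _) (fun i => (hp i).comp_linearMap (innerCoords d e).toLinearMap)
    fun i => (hq i).comp_linearMap (innerCoords d e).toLinearMap
  have h₂ : Realizable {x : Fin d → E | ∀ i, x i ∈ Submodule.span ℝ {e} ∧ ‖x i‖ ≤ max R 1} := by
    simpa using h₀.setOf_forall fun i =>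
      h₀.inter ((realizable_line hE he0 hR').comap fun _ : Unit => i)
  convert h₁.inter h₂ using 1
  ext φ
  simp only [Set.mem_ofPred_eq, Set.mem_inter_iff, sub_zero, Submodule.mem_span_singleton]
  constructor
  · rintro ⟨hφ, hs⟩
    have hb (i) : ‖φ i‖ ≤ max R 1 := by
      rw [← hs, smulCoords_apply, norm_smul, he, mul_one]
      exact ((PiLp.norm_apply_le _ i).trans (hR _ hφ)).trans (le_max_left _ _)
    exact ⟨⟨hb, hφ⟩, fun i => ⟨⟨_, congrFun hs i⟩, hb i⟩⟩
  · rintro ⟨⟨-, hφ⟩, h⟩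
    refine ⟨hφ, funext fun i => ?_⟩
    obtain ⟨⟨t, ht⟩, -⟩ := h i
    rw [smulCoords_apply, innerCoords_apply, ← ht, real_inner_smul_right,
      real_inner_self_eq_norm_sq, he, one_pow, mul_one]

end Coords

theorem IsQuasialgebraic.exists_cabledLinkage (hn : 2 ≤ n) {d : ℕ}
    {X : Set (EuclideanSpace ℝ (Fin d))} (hX : IsQuasialgebraic X) (hc : IsCompact X) (k : ℕ) :
    ∃ (N : ℕ) (L : CabledLinkage n (Fin N)) (f : L.configSpace ≃ₜ timesEuclidean X n k),
      IsAnalyticIsomorphism f := by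
  have hE : 2 ≤ Module.finrank ℝ (EuclideanSpace ℝ (Fin n)) := by simpa
  obtain ⟨e, he⟩ : ∃ e : EuclideanSpace ℝ (Fin n), ‖e‖ = 1 :=
    ⟨EuclideanSpace.single ⟨0, by omega⟩ 1, by simp⟩
  obtain ⟨m, S, G, r, hm, hS, hG, hmem, hr⟩ :=
    (realizable_image_smulCoords hE he hX hc).exists_graph k
  have : Nontrivial (Fin (d + m)) := Fin.nontrivial_iff_two_le.2 (by omega)
  obtain ⟨L, hL⟩ := (hS.comap (finSumFinEquiv (m := d) (n := m))).exists_cabledLinkage_of_nontrivial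
  have hL' (φ) (hφ : φ ∈ L.configSpace) : (innerCoords d e (fun i => φ (finSumFinEquiv (.inl i))) ∈ X ∧
      smulCoords d e (innerCoords d e (fun i => φ (finSumFinEquiv (.inl i)))) =
        fun i => φ (finSumFinEquiv (.inl i))) ∧ (fun i => φ (finSumFinEquiv (.inr i))) =
        G (fun i => φ (finSumFinEquiv (.inl i)), fun i => φ (finSumFinEquiv (.inr (r i)))) := by
    rw [hL, Set.mem_ofPred_eq, ← Sum.elim_comp_inl_inr (φ ∘ finSumFinEquiv), hmem] at hφ
    exact hφ
  suffices h : ∃ f : timesEuclidean X n k ≃ₜ L.configSpace, IsAnalyticIsomorphism f by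
    obtain ⟨f, hf⟩ := h
    exact ⟨d + m, L, f.symm, hf.symm⟩
  refine (exists_isAnalyticIsomorphism
    (g := fun z j => (Sum.elim (smulCoords d e z.1) (G (smulCoords d e z.1, z.2)) :
      Fin d ⊕ Fin m → _) (finSumFinEquiv.symm j))
    (h := fun φ => (innerCoords d e (fun i => φ (finSumFinEquiv (.inl i))),
      fun i => φ (finSumFinEquiv (.inr (r i))))) ?_ ?_ (fun z hz => ?_) (fun φ hφ => ?_)
      (fun z _ => ?_) fun φ hφ => ?_).imp fun _ h => h.1
  · have h₁ : AnalyticOnNhd ℝ (fun z : EuclideanSpace ℝ (Fin d) ×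
        (Fin k → EuclideanSpace ℝ (Fin n)) => smulCoords d e z.1) (timesEuclidean X n k) :=
      ((smulCoords d e).analyticOnNhd Set.univ).comp analyticOnNhd_fst fun z _ => trivial
    refine AnalyticOnNhd.pi fun j => ?_
    obtain ⟨j, rfl⟩ := finSumFinEquiv.surjective j
    simp only [Equiv.symm_apply_apply]
    rcases j with j | j
    · exact (analyticOnNhd_eval Set.univ j).comp h₁ fun z _ => trivial
    · refine (analyticOnNhd_eval Set.univ j).comp (hG.comp (h₁.prod analyticOnNhd_snd)
        fun z hz => ⟨⟨?_, ?_⟩, trivial⟩) fun z _ => trivial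
      · rw [innerCoords_smulCoords he]
        exact hz.1
      · rw [innerCoords_smulCoords he]
  · exact (((innerCoords d e).analyticOnNhd Set.univ).comp
      (AnalyticOnNhd.pi fun i => analyticOnNhd_eval _ _) fun z _ => trivial).prod
      (AnalyticOnNhd.pi fun i => analyticOnNhd_eval _ _)
  · rw [hL]
    have : (fun j => (Sum.elim (smulCoords d e z.1) (G (smulCoords d e z.1, z.2)) :
        Fin d ⊕ Fin m → _) (finSumFinEquiv.symm j)) ∘ finSumFinEquiv =
        Sum.elim (smulCoords d e z.1) (G (smulCoords d e z.1, z.2)) := by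
      funext j
      simp
    rw [Set.mem_ofPred_eq, this, hmem, hr]
    refine ⟨⟨?_, ?_⟩, rfl⟩
    · rw [innerCoords_smulCoords he]
      exact hz.1
    · rw [innerCoords_smulCoords he]
  · exact ⟨(hL' φ hφ).1.1, trivial⟩
  · refine Prod.ext ?_ ?_
    · simp only [Equiv.symm_apply_apply]
      exact innerCoords_smulCoords he z.1
    · simp only [Equiv.symm_apply_apply]
      exact hr (smulCoords d e z.1) z.2
  · obtain ⟨⟨-, h₁⟩, h₂⟩ := hL' φ hφ
    funext j
    obtain ⟨j, rfl⟩ := finSumFinEquiv.surjective j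
    simp only [Equiv.symm_apply_apply, h₁, ← h₂]
    rcases j with j | j <;> rfl

end Realization

/-! ### Configuration spaces are quasialgebraic -/

namespace IsPolynomialFunction

variable {E : Type*} [AddCommGroup E] [Module ℝ E] {p q : E → ℝ}

theorem const (c : ℝ) : IsPolynomialFunction fun _ : E => c :=
  ⟨MvPolynomial.C c, fun _ => by simp⟩

theorem linear (l : Module.Dual ℝ E) : IsPolynomialFunction fun x => l x :=
  ⟨MvPolynomial.X l, fun _ => by simp⟩

theorem sub (hp : IsPolynomialFunction p) (hq : IsPolynomialFunction q) :
    IsPolynomialFunction fun x => p x - q x :=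
  let ⟨P, hP⟩ := hp
  let ⟨Q, hQ⟩ := hq
  ⟨P - Q, fun x => by simp only [map_sub, hP, hQ]⟩

theorem pow (hp : IsPolynomialFunction p) (m : ℕ) : IsPolynomialFunction fun x => p x ^ m :=
  let ⟨P, hP⟩ := hp
  ⟨P ^ m, fun x => by simp only [map_pow, hP]⟩

theorem sum {J : Type*} (s : Finset J) {p : J → E → ℝ} (hp : ∀ j, IsPolynomialFunction (p j)) :
    IsPolynomialFunction fun x => ∑ j ∈ s, p j x := by
  choose P hP using hp
  exact ⟨∑ j ∈ s, P j, fun x => by simp only [map_sum, hP]⟩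

theorem norm_sub_sq {n : ℕ} (g : E →ₗ[ℝ] EuclideanSpace ℝ (Fin n))
    (c : EuclideanSpace ℝ (Fin n)) : IsPolynomialFunction fun x => ‖g x - c‖ ^ 2 := by
  simp only [EuclideanSpace.norm_sq_eq, PiLp.sub_apply, Real.norm_eq_abs, sq_abs]
  exact sum _ fun i =>
    ((linear ((EuclideanSpace.proj i : _ →L[ℝ] ℝ).toLinearMap ∘ₗ g)).sub (const (c i))).pow 2

end IsPolynomialFunction

namespace IsQuasialgebraic

variable {E : Type*} [AddCommGroup E] [Module ℝ E]

theorem univ : IsQuasialgebraic (Set.univ : Set E) :=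
  ⟨0, 0, Fin.elim0, Fin.elim0, fun i => i.elim0, fun i => i.elim0, by
    ext
    simp⟩

theorem setOf_eq_zero {p : E → ℝ} (hp : IsPolynomialFunction p) :
    IsQuasialgebraic {x | p x = 0} :=
  ⟨1, 0, fun _ => p, Fin.elim0, fun _ => hp, fun i => i.elim0, by simp⟩

theorem setOf_nonneg {p : E → ℝ} (hp : IsPolynomialFunction p) :
    IsQuasialgebraic {x | 0 ≤ p x} :=
  ⟨0, 1, Fin.elim0, fun _ => p, fun i => i.elim0, fun _ => hp, by simp⟩

theorem setOf_and {P Q : E → Prop} (hP : IsQuasialgebraic {x | P x})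
    (hQ : IsQuasialgebraic {x | Q x}) : IsQuasialgebraic {x | P x ∧ Q x} := by
  obtain ⟨a, b, p, q, hp, hq, h⟩ := hP
  obtain ⟨a', b', p', q', hp', hq', h'⟩ := hQ
  refine ⟨a + a', b + b', Fin.append p p', Fin.append q q', ?_, ?_, ?_⟩
  · intro i
    refine Fin.addCases (fun i => ?_) (fun i => ?_) i
    · simpa using hp i
    · simpa using hp' i
  · intro i
    refine Fin.addCases (fun i => ?_) (fun i => ?_) i
    · simpa using hq i
    · simpa using hq' i
  · ext x
    have h₁ : P x ↔ _ := Set.ext_iff.1 h x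
    have h₂ : Q x ↔ _ := Set.ext_iff.1 h' x
    simp only [Set.mem_ofPred_eq] at h₁ h₂ ⊢
    rw [h₁, h₂, ← finSumFinEquiv.forall_congr_right, ← finSumFinEquiv.forall_congr_right]
    simp only [Sum.forall, finSumFinEquiv_apply_left, finSumFinEquiv_apply_right,
      Fin.append_left, Fin.append_right]
    tauto

theorem setOf_forall {J : Type*} [Finite J] {P : J → E → Prop}
    (h : ∀ j, IsQuasialgebraic {x | P j x}) : IsQuasialgebraic {x | ∀ j, P j x} := by
  classical
  cases nonempty_fintype J
  have (s : Finset J) : IsQuasialgebraic {x | ∀ j ∈ s, P j x} := by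
    induction s using Finset.induction_on with
    | empty => simpa using univ
    | insert a s _ ih => simpa using setOf_and (h a) ih
  simpa using this Finset.univ

/-- The squared distance turns a vector equation into one polynomial equation. -/
theorem setOf_map_eq {n : ℕ} (g : E →ₗ[ℝ] EuclideanSpace ℝ (Fin n))
    (c : EuclideanSpace ℝ (Fin n)) : IsQuasialgebraic {x | g x = c} := by
  simpa [sub_eq_zero] using setOf_eq_zero (IsPolynomialFunction.norm_sub_sq g c)

theorem setOf_apply_eq {n : ℕ} {V : Type*} (v : V) (c : EuclideanSpace ℝ (Fin n)) :
    IsQuasialgebraic {φ : V → EuclideanSpace ℝ (Fin n) | φ v = c} :=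
  setOf_map_eq (LinearMap.proj (R := ℝ) (φ := fun _ : V => EuclideanSpace ℝ (Fin n)) v) c

theorem setOf_norm_eq {n : ℕ} (g : E →ₗ[ℝ] EuclideanSpace ℝ (Fin n)) {l : ℝ} (hl : 0 ≤ l) :
    IsQuasialgebraic {x | ‖g x‖ = l} := by
  have h (y : EuclideanSpace ℝ (Fin n)) : ‖y‖ = l ↔ ‖y‖ ^ 2 = l ^ 2 :=
    (sq_eq_sq₀ (norm_nonneg _) hl).symm
  simpa [sub_eq_zero, h] using
    setOf_eq_zero ((IsPolynomialFunction.norm_sub_sq g 0).sub (.const (l ^ 2)))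

theorem setOf_norm_le {n : ℕ} (g : E →ₗ[ℝ] EuclideanSpace ℝ (Fin n)) {l : ℝ} (hl : 0 ≤ l) :
    IsQuasialgebraic {x | ‖g x‖ ≤ l} := by
  have h (y : EuclideanSpace ℝ (Fin n)) : ‖y‖ ≤ l ↔ ‖y‖ ^ 2 ≤ l ^ 2 :=
    (sq_le_sq₀ (norm_nonneg _) hl).symm
  simpa [sub_nonneg, h] using
    setOf_nonneg ((IsPolynomialFunction.const (l ^ 2)).sub (.norm_sub_sq g 0))

theorem preimage {F : Type*} [AddCommGroup F] [Module ℝ F] {X : Set F} (hX : IsQuasialgebraic X)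
    (g : E →ₗ[ℝ] F) : IsQuasialgebraic {x | g x ∈ X} := by
  obtain ⟨a, b, p, q, hp, hq, rfl⟩ := hX
  exact ⟨a, b, fun i x => p i (g x), fun j x => q j (g x), fun i => (hp i).comp_linearMap g,
    fun j => (hq j).comp_linearMap g, rfl⟩

end IsQuasialgebraic

theorem IsEntireRational.of_linearMap {E F : Type*} [AddCommGroup E] [Module ℝ E]
    [AddCommGroup F] [Module ℝ F] (g : E →ₗ[ℝ] F) : IsEntireRational g := fun l =>
  ⟨fun x => (l ∘ₗ g) x, fun _ => 1, .linear _, .const 1, fun _ => one_ne_zero, fun x => by simp⟩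

/-! ### Splitting off the translations of free components -/

namespace CabledLinkage

variable {n : ℕ} {V : Type*} (L : CabledLinkage n V)

theorem norm_sub_le_of_adj {φ : V → EuclideanSpace ℝ (Fin n)} (hφ : φ ∈ L.configSpace) {v w : V}
    (h : L.graph.Adj v w) : ‖φ v - φ w‖ ≤ L.length ⟨s(v, w), h⟩ := by
  by_cases hf : ⟨s(v, w), h⟩ ∈ L.flexible
  · exact (hφ.2 v w h).1 hf
  · exact ((hφ.2 v w h).2 hf).le

theorem exists_norm_sub_le {v w : V} (h : L.graph.Reachable v w) :
    ∃ K, ∀ φ ∈ L.configSpace, ‖φ v - φ w‖ ≤ K := by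
  obtain ⟨p⟩ := h
  induction p with
  | nil => exact ⟨0, by simp⟩
  | cons h p ih =>
    obtain ⟨K, hK⟩ := ih
    exact ⟨_, fun φ hφ => (norm_sub_le_norm_sub_add_norm_sub _ _ _).trans
      (add_le_add (L.norm_sub_le_of_adj hφ h) (hK φ hφ))⟩

/-- The connected components without fixed vertices. -/
abbrev FreeComponent : Type _ :=
  {c : L.graph.ConnectedComponent // ∀ v ∈ c.supp, v ∉ L.fixed}

/-- A vertex of a component. -/
noncomputable def base (c : L.graph.ConnectedComponent) : V :=
  c.nonempty_supp.some

theorem mk_base (c : L.graph.ConnectedComponent) :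
    L.graph.connectedComponentMk (L.base c) = c :=
  c.nonempty_supp.some_mem

/-- The configurations in which the base vertices of all free components are at the origin. -/
def reducedConfigSpace : Set (V → EuclideanSpace ℝ (Fin n)) :=
  {φ | φ ∈ L.configSpace ∧ ∀ c : L.FreeComponent, φ (L.base c) = 0}

theorem isQuasialgebraic_configSpace [Finite V] : IsQuasialgebraic L.configSpace := by
  refine .setOf_and (.setOf_forall fun v => ?_) (.setOf_forall fun v => .setOf_forall fun w => ?_)
  · exact .setOf_apply_eq _ _
  · by_cases h : L.graph.Adj v w
    · simp only [h, forall_true_left]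
      have hl := (L.length_pos ⟨s(v, w), h⟩).le
      let g : (V → EuclideanSpace ℝ (Fin n)) →ₗ[ℝ] EuclideanSpace ℝ (Fin n) :=
        LinearMap.proj (R := ℝ) (φ := fun _ : V => EuclideanSpace ℝ (Fin n)) v -
          LinearMap.proj (R := ℝ) (φ := fun _ : V => EuclideanSpace ℝ (Fin n)) w
      have hg (φ) : g φ = φ v - φ w := rfl
      by_cases hf : ⟨s(v, w), h⟩ ∈ L.flexible
      · simpa [hf, hg] using IsQuasialgebraic.setOf_norm_le g hl
      · simpa [hf, hg] using IsQuasialgebraic.setOf_norm_eq g hl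
    · simpa [h] using IsQuasialgebraic.univ

theorem isQuasialgebraic_reducedConfigSpace [Finite V] :
    IsQuasialgebraic L.reducedConfigSpace := by
  have : Finite L.graph.ConnectedComponent := Quot.finite _
  exact .setOf_and L.isQuasialgebraic_configSpace
    (.setOf_forall fun c => .setOf_apply_eq _ _)

theorem _root_.IsQuasialgebraic.isClosed {E : Type*} [NormedAddCommGroup E] [NormedSpace ℝ E]
    [FiniteDimensional ℝ E] {X : Set E} (hX : IsQuasialgebraic X) : IsClosed X := by
  have hc {p : E → ℝ} (hp : IsPolynomialFunction p) : Continuous p := by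
    obtain ⟨P, hP⟩ := hp
    rw [funext hP]
    exact (MvPolynomial.continuous_eval P).comp
      (continuous_pi fun l : Module.Dual ℝ E => l.continuous_of_finiteDimensional)
  obtain ⟨a, b, p, q, hp, hq, rfl⟩ := hX
  simp only [Set.ofPred_and, Set.ofPred_forall]
  exact (isClosed_iInter fun i => isClosed_eq (hc (hp i)) continuous_const).inter
    (isClosed_iInter fun j => isClosed_le continuous_const (hc (hq j)))

/-- Every component is anchored, either by a fixed vertex or by its base vertex at the origin, and
paths of edges bound the distance to the anchor. -/
theorem exists_norm_le_reducedConfigSpace (v : V) :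
    ∃ K, ∀ φ ∈ L.reducedConfigSpace, ‖φ v‖ ≤ K := by
  by_cases h : ∀ w ∈ (L.graph.connectedComponentMk v).supp, w ∉ L.fixed
  · obtain ⟨K, hK⟩ := L.exists_norm_sub_le (v := v)
      (SimpleGraph.ConnectedComponent.exact (L.mk_base (L.graph.connectedComponentMk v)).symm)
    refine ⟨K, fun φ hφ => ?_⟩
    simpa [hφ.2 ⟨_, h⟩] using hK φ hφ.1
  · push Not at h
    obtain ⟨w, hw, hfix⟩ := h
    obtain ⟨K, hK⟩ := L.exists_norm_sub_le (v := v) (SimpleGraph.ConnectedComponent.exact hw.symm)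
    refine ⟨K + ‖L.position ⟨w, hfix⟩‖, fun φ hφ => ?_⟩
    rw [← hφ.1.1 ⟨w, hfix⟩, ← sub_le_iff_le_add]
    exact (norm_sub_norm_le _ _).trans (hK φ hφ.1)

theorem isCompact_reducedConfigSpace [Fintype V] : IsCompact L.reducedConfigSpace := by
  choose K hK using L.exists_norm_le_reducedConfigSpace
  refine (isCompact_box (fun _ : V => (0 : EuclideanSpace ℝ (Fin n))) K).of_isClosed_subset
    L.isQuasialgebraic_reducedConfigSpace.isClosed fun φ hφ v => ?_
  simpa using hK v φ hφ

open Classical in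
/-- Translation of the vertices in free components by given vectors. -/
noncomputable def translation :
    (L.FreeComponent → EuclideanSpace ℝ (Fin n)) →ₗ[ℝ] V → EuclideanSpace ℝ (Fin n) :=
  LinearMap.pi fun v => if h : ∀ w ∈ (L.graph.connectedComponentMk v).supp, w ∉ L.fixed then
    LinearMap.proj ⟨_, h⟩ else 0

theorem translation_base (t : L.FreeComponent → EuclideanSpace ℝ (Fin n)) (c : L.FreeComponent) :
    L.translation t (L.base c) = t c := by
  have h : ∀ w ∈ (L.graph.connectedComponentMk (L.base c)).supp, w ∉ L.fixed := by
    rw [mk_base]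
    exact c.2
  simp only [translation, LinearMap.pi_apply, dif_pos h, LinearMap.proj_apply]
  congr 1
  exact Subtype.ext (L.mk_base c)

/-- The displacement is constant on components and zero on those with fixed vertices, so edge
vectors and fixed positions do not change. -/
theorem add_translation_mem {φ : V → EuclideanSpace ℝ (Fin n)} (hφ : φ ∈ L.configSpace)
    (t : L.FreeComponent → EuclideanSpace ℝ (Fin n)) : φ + L.translation t ∈ L.configSpace := by
  refine ⟨fun v => ?_, fun v w h => ?_⟩
  · have h : ¬∀ w ∈ (L.graph.connectedComponentMk (v : V)).supp, w ∉ L.fixed :=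
      fun h => h v rfl v.2
    simp [translation, dif_neg h, hφ.1 v]
  · have : L.translation t v = L.translation t w := by
      simp only [translation, LinearMap.pi_apply]
      rw [SimpleGraph.ConnectedComponent.sound h.reachable]
    simpa [this] using hφ.2 v w h

/-- The positions of the base vertices of the free components. -/
noncomputable def basePositions :
    (V → EuclideanSpace ℝ (Fin n)) →ₗ[ℝ] L.FreeComponent → EuclideanSpace ℝ (Fin n) :=
  LinearMap.pi fun c => LinearMap.proj (L.base c)

theorem areIsomorphic_configSpace [Finite V] :
    ∃ (d : ℕ) (X : Set (EuclideanSpace ℝ (Fin d))), IsCompact X ∧ IsQuasialgebraic X ∧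
      AreIsomorphic L.configSpace (timesEuclidean X n L.numFreeComponents) := by
  cases nonempty_fintype V
  have : Finite L.graph.ConnectedComponent := Quot.finite _
  let i : L.FreeComponent ≃ Fin L.numFreeComponents := Finite.equivFin _
  let d := Module.finrank ℝ (V → EuclideanSpace ℝ (Fin n))
  let A : EuclideanSpace ℝ (Fin d) ≃L[ℝ] (V → EuclideanSpace ℝ (Fin n)) :=
    ContinuousLinearEquiv.ofFinrankEq (by simp [d])
  let r : (L.FreeComponent → EuclideanSpace ℝ (Fin n)) ≃ₗ[ℝ]
      (Fin L.numFreeComponents → EuclideanSpace ℝ (Fin n)) := LinearEquiv.funCongrLeft ℝ _ i.symm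
  -- Each free component is moved back until its base vertex is at 0, and the base positions are
  -- recorded; `h` undoes this. Both maps are linear, hence entire rational.
  let g : (V → EuclideanSpace ℝ (Fin n)) →ₗ[ℝ] EuclideanSpace ℝ (Fin d) ×
      (Fin L.numFreeComponents → EuclideanSpace ℝ (Fin n)) :=
    (A.symm.toLinearEquiv.toLinearMap ∘ₗ (LinearMap.id - L.translation ∘ₗ L.basePositions)).prod
      (r.toLinearMap ∘ₗ L.basePositions)
  let h : EuclideanSpace ℝ (Fin d) × (Fin L.numFreeComponents → EuclideanSpace ℝ (Fin n)) →ₗ[ℝ]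
      (V → EuclideanSpace ℝ (Fin n)) :=
    A.toLinearEquiv.toLinearMap.coprod (L.translation ∘ₗ r.symm.toLinearMap)
  have hg (φ) : g φ = (A.symm (φ - L.translation (L.basePositions φ)), r (L.basePositions φ)) :=
    rfl
  have hh (z) : h z = A z.1 + L.translation (r.symm z.2) := by simp [h]
  have hhg (φ) : h (g φ) = φ := by simp [hg, hh]
  have hbase (t) : L.basePositions (L.translation t) = t :=
    funext fun c => L.translation_base t c
  have hgX (φ) (hφ : φ ∈ L.configSpace) :
      g φ ∈ timesEuclidean {x | A x ∈ L.reducedConfigSpace} n L.numFreeComponents := by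
    refine ⟨?_, trivial⟩
    rw [hg, Set.mem_ofPred_eq, A.apply_symm_apply]
    refine ⟨?_, fun c => ?_⟩
    · rw [sub_eq_add_neg, ← map_neg]
      exact L.add_translation_mem hφ _
    · rw [Pi.sub_apply, translation_base]
      exact sub_self _
  have hhX (z) (hz : z ∈ timesEuclidean {x | A x ∈ L.reducedConfigSpace} n L.numFreeComponents) :
      h z ∈ L.configSpace := by
    rw [hh]
    exact L.add_translation_mem hz.1.1 _
  have hgh (z) (hz : z ∈ timesEuclidean {x | A x ∈ L.reducedConfigSpace} n L.numFreeComponents) :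
      g (h z) = z := by
    have h₀ : L.basePositions (A z.1) = 0 := funext fun c => hz.1.2 c
    rw [hg, hh, map_add, h₀, zero_add, hbase]
    simp
  refine ⟨d, {x | A x ∈ L.reducedConfigSpace}, ?_,
    L.isQuasialgebraic_reducedConfigSpace.preimage A.toLinearEquiv.toLinearMap,
    { toFun := fun φ => ⟨g φ, hgX φ φ.2⟩
      invFun := fun z => ⟨h z, hhX z z.2⟩
      left_inv := fun φ => Subtype.ext (hhg φ)
      right_inv := fun z => Subtype.ext (hgh z z.2)
      continuous_toFun :=
        (g.continuous_of_finiteDimensional.comp continuous_subtype_val).subtype_mk _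
      continuous_invFun :=
        (h.continuous_of_finiteDimensional.comp continuous_subtype_val).subtype_mk _ },
    g, h, .of_linearMap g, .of_linearMap h, fun _ => rfl, fun _ => rfl⟩
  exact A.toHomeomorph.isCompact_preimage.2 L.isCompact_reducedConfigSpace

end CabledLinkage

theorem mainTheorem2 (n : ℕ) (hn : 2 ≤ n) :
    -- configuration spaces are compact quasialgebraic sets times `(ℝⁿ)ᵏ`
    (∀ (V : Type*) [Finite V] (L : CabledLinkage n V),
      ∃ (d : ℕ) (X : Set (EuclideanSpace ℝ (Fin d))),
        IsCompact X ∧ IsQuasialgebraic X ∧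
          AreIsomorphic L.configSpace (timesEuclidean X n L.numFreeComponents)) ∧
    -- realization up to analytic isomorphism, for `X` in any `ℝᵈ`
    (∀ (d : ℕ) (X : Set (EuclideanSpace ℝ (Fin d))), IsCompact X → IsQuasialgebraic X →
      ∀ k : ℕ, ∃ (N : ℕ) (L : CabledLinkage n (Fin N))
        (f : L.configSpace ≃ₜ timesEuclidean X n k), IsAnalyticIsomorphism f) ∧
    -- realization as a graph, for `X` in `(ℝⁿ)ˢ`
    (∀ (s : ℕ) (X : Set (Fin s → EuclideanSpace ℝ (Fin n))), IsCompact X → IsQuasialgebraic X →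
      ∀ k : ℕ, ∃ (m : ℕ) (L : CabledLinkage n (Fin s ⊕ Fin m))
        (α : timesEuclidean X n k → (Fin m → EuclideanSpace ℝ (Fin n))),
        IsAnalyticRestriction α ∧
        L.configSpace = {φ | ∃ z : timesEuclidean X n k, φ = Sum.elim z.1.1 (α z)} ∧
        ∃ f : timesEuclidean X n k ≃ₜ L.configSpace,
          IsAnalyticIsomorphism f ∧
            ∀ z, (f z : Fin s ⊕ Fin m → EuclideanSpace ℝ (Fin n)) = Sum.elim z.1.1 (α z)) := by
  have hE : 2 ≤ Module.finrank ℝ (EuclideanSpace ℝ (Fin n)) := by simpa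
  exact ⟨fun V _ L => L.areIsomorphic_configSpace,
    fun d X hc hX k => hX.exists_cabledLinkage hn hc k,
    fun s X hc hX k => (hX.realizable hE hc).exists_cabledLinkage_graph k⟩
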